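/- Let $\mathcal V$ be the set of $V\in C^\infty((0,\infty),\mathbb R)$ such that $V(x)\to+\infty$ as $x\to0^+$; for some $S\in(0,\infty]$ one has $V'<0$, $V''>0$ and $V'/V''$ decreasing on $(0,S)$; and $V'/V''$, extended by its limit $0$ at $x=0$, has a (right) derivative smaller than $-\tfrac12$ at $0$. Let $\mathcal V^*$ be the set of $V\in\mathcal V$ such that $\lim_{\lambda\to0^+}V(\lambda x)/V(\lambda)=1$ uniformly for $x\in[1,M]$, for every $M\ge1$. For $V\in\mathcal V$ put $\bar R=\min\{B,S\}$, where $S$ is as above and $B\in(0,\infty]$ is such that $V'(x)/V''(x)\le-x/2$ for $0<x<B$. For $\varepsilon>0$ let $V_\varepsilon(x)=V(\sqrt{x^2+\varepsilon^2})$ and let $P(\varepsilon)$ be the system $\ddot x=\nabla V_\varepsilon(|x|)$ in $\mathbb R^2$; let $P(0)$ be the system $\ddot x=\nabla V(|x|)$ in $\mathbb R^2\setminus\{0\}$. Solutions of $P(0)$ are continued through a collision (that is, $x(\tau)=0$) by transmission: $x(\tau+s)=-x(\tau-s)$, $\dot x(\tau+s)=\dot x(\tau-s)$ for small $s>0$,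 and then again by the equation of motion. For $\varepsilon\ge0$ and $y\in\mathbb R^2\times\mathbb R^2$ let $\Phi_T(y,\varepsilon)=(x(T),\dot x(T))$ be the state at time $T$ of the solution of $P(\varepsilon)$ with initial state $(x(0),\dot x(0))=y$, extended by transmission if $\varepsilon=0$, whenever this solution exists up to time $T$ (and, if $\varepsilon=0$, times $0$ and $T$ are not collision times). **Theorem.** Let $V\in\mathcal V^*$, and let $\bar y=(\bar q,\bar p)$ with $0<|\bar q|\le\bar R$ be an initial state whose solution $\bar x:[0,T_0)\to\mathbb R^2\setminus\{0\}$ of $P(0)$ has a collision at time $T_0>0$, i.e. $\bar x(t)\to0$ as $t\to T_0^-$. Then, for $T_0<T\le 2T_0$, the state $\Phi_T(\bar y,0)$ is defined and is equal to $(-\bar x(2T_0-T),\dot{\bar x}(2T_0-T))$. Moreover, for every $T>T_0$ for which $\Phi_T(\bar y,0)$ is defined and has nonzero velocity $\dot x(T)\neq0$, the state $\Phi_T(y,\varepsilon)$ exists and is unique for all $(y,\varepsilon)$ with $\varepsilon\ge0$ close enough to $(\bar y,0)$, and $$\lim_{\substack{(y,\varepsilon)\to(\bar y,0)\\ \varepsilon\ge0}}\Phi_T(y,\varepsilon)=\Phi_T(\bar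 y,0).$$ -/

import Mathlib

open Set Filter Topology
open scoped ContDiff

noncomputable section

namespace OneCentre

/-- The configuration plane `ℝ²` with its Euclidean norm. -/
abbrev Plane : Type := EuclideanSpace ℝ (Fin 2)

/-- The phase space of pairs (position, velocity). -/
abbrev Phase : Type := Plane × Plane

/-! ### The classes of potentials -/

/-- Conditions **ii** and **iii** on `(0, S)`, where `S` may be `⊤`:
`V' < 0`, `V'' > 0` and `V' / V''` is decreasing. -/
def DecreasingConvexOn (V : ℝ → ℝ) (S : EReal) : Prop :=
  (∀ x : ℝ, 0 < x → (x : EReal) < S → deriv V x < 0 ∧ 0 < deriv (deriv V) x) ∧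
  AntitoneOn (fun x => deriv V x / deriv (deriv V) x) {x : ℝ | 0 < x ∧ (x : EReal) < S}

/-- The inequality `V' / V'' ≤ - x / 2` on `(0, B)`, where `B` may be `⊤`. -/
def RatioBoundOn (V : ℝ → ℝ) (B : EReal) : Prop :=
  ∀ x : ℝ, 0 < x → (x : EReal) < B → deriv V x / deriv (deriv V) x ≤ -x / 2

/-- The class `𝒱`. A function on `(0, ∞)` is represented by a function on `ℝ` whose values on
`(-∞, 0]` are irrelevant. The other conditions force `V' / V''` to tend to `0` at `0⁺`,
so in the last one it is extended to `0` by the value `0`, and the derivative is one-sided. -/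
structure ClassV (V : ℝ → ℝ) : Prop where
  smooth : ContDiffOn ℝ ∞ V (Ioi 0)
  singular : Tendsto V (𝓝[>] 0) atTop
  decreasingConvex : ∃ S : EReal, 0 < S ∧ DecreasingConvexOn V S
  ratioDeriv : ∃ d : ℝ, d < -(1 / 2) ∧
    HasDerivWithinAt (fun x => if 0 < x then deriv V x / deriv (deriv V) x else 0) d (Ici 0) 0

/-- The class `𝒱*`: moreover `V (λ x) / V λ → 1` as `λ → 0⁺`, uniformly for `x ∈ [1, M]`,
for every `M`. -/
structure ClassVStar (V : ℝ → ℝ) : Prop extends ClassV V where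
  slowlyVarying : ∀ M : ℝ, 1 ≤ M →
    TendstoUniformlyOn (fun l x : ℝ => V (l * x) / V l) (fun _ => 1) (𝓝[>] 0) (Icc 1 M)

/-! ### The singular and the smoothed problem -/

/-- The smoothed potential `V_ε(x) = V(√(x² + ε²))`; for `ε = 0` and `x > 0` it is `V(x)`. -/
def smoothed (V : ℝ → ℝ) (ε x : ℝ) : ℝ := V (Real.sqrt (x ^ 2 + ε ^ 2))

/-- The force `∇ V_ε(|u|)`. -/
def force (V : ℝ → ℝ) (ε : ℝ) (u : Plane) : Plane :=
  gradient (fun w : Plane => smoothed V ε ‖w‖) u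

/-- `(x, v)` solves `ẋ = v`, `v̇ = ∇V_ε(|x|)` at every time of the time set `J` (with one-sided
derivatives at the end points that belong to `J`). If `ε = 0`, the path has to avoid the origin. -/
def IsSolutionOn (V : ℝ → ℝ) (ε : ℝ) (J : Set ℝ) (x v : ℝ → Plane) : Prop :=
  ∀ t ∈ J, (0 < ε ∨ x t ≠ 0) ∧ HasDerivWithinAt x (v t) J t ∧
    HasDerivWithinAt v (force V ε (x t)) J t

/-- `(x, v)` is a solution of the singular problem on `[0, T₀)` with a collision at time `T₀`. -/
def IsCollisionSolution (V : ℝ → ℝ) (T₀ : ℝ) (x v : ℝ → Plane) : Prop :=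
  0 < T₀ ∧ IsSolutionOn V 0 (Ico 0 T₀) x v ∧ Tendsto x (𝓝[<] T₀) (𝓝 0)

/-- A trajectory on `[0, T]` of the singular problem, continued through each of its collisions by
transmission: it solves the equations of motion at the times that are not collisions, and at a
collision time `τ` it is continued by `x (τ + s) = - x (τ - s)`, `v (τ + s) = v (τ - s)`.
The times `0` and `T` are not collisions. -/
structure IsTransmissionSolution (V : ℝ → ℝ) (T : ℝ) (x v : ℝ → Plane) : Prop where
  start_ne : x 0 ≠ 0
  end_ne : x T ≠ 0
  continuousOn : ContinuousOn x (Icc 0 T)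
  motion : ∀ t ∈ Icc 0 T, x t ≠ 0 → HasDerivWithinAt x (v t) (Icc 0 T) t ∧
    HasDerivWithinAt v (force V 0 (x t)) (Icc 0 T) t
  transmission : ∀ τ ∈ Icc 0 T, x τ = 0 →
    ∀ᶠ s in 𝓝[>] (0 : ℝ), x (τ - s) ≠ 0 ∧ x (τ + s) = -x (τ - s) ∧ v (τ + s) = v (τ - s)

/-- `z` is the state at time `T` of the flow of parameter `ε ≥ 0` that starts at `y`: the smoothed
flow if `ε > 0`, the singular flow with the transmission extension if `ε = 0`. -/
def FlowsTo (V : ℝ → ℝ) (T : ℝ) (y : Phase) (ε : ℝ) (z : Phase) : Prop :=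
  ∃ x v : ℝ → Plane, (x 0, v 0) = y ∧ (x T, v T) = z ∧
    ((0 < ε ∧ IsSolutionOn V ε (Icc 0 T) x v) ∨ (ε = 0 ∧ IsTransmissionSolution V T x v))

open Classical in
/-- The time-`T` map `Φ_T(y, ε)`, with the value `0` where the flow is not defined up to `T`. -/
def timeMap (V : ℝ → ℝ) (T : ℝ) (p : Phase × ℝ) : Phase :=
  if h : ∃ z, FlowsTo V T p.1 p.2 z then h.choose else 0

end OneCentre

end

/-! Away from collisions everything is smooth dependence on initial data: with `ε` as an extra
constant component of the state, the equations of motion form one `C¹` autonomous system on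
`regularSet`, so states near a regular piece of trajectory, for small `ε ≥ 0`, stay near it. The
whole difficulty is a short time interval around a collision.

The decisive estimate is that a trajectory crossing a small disc about the centre hardly turns.
Convexity and slow variation give `-x V'(x) = o(V(x))` (`ClassVStar.exists_isScale`), and where `V`
is large the speed satisfies `‖v‖² ≥ V`. With angular momentum `c ≠ 0`, the turning rate of the
velocity is then at most `2η` times the derivative of `arctan (⟨x, v⟩ / |c|)`, whose total variation
is at most `π` however small `c` is. So the total turning is at most `2πη`
(`IsSolutionOn.norm_dir_sub_le`), and as `ε` and `c` tend to `0` the deflection disappears: the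
limit is transmission.

In `ClassVStar.exists_pass` this shows that nearby trajectories leave a small disc after a short
time. Energy and angular momentum fix the exit speed and its radial component, so the exit state is
close to `(r₂ • e', w₂ • e')` with `e'` close to the incoming direction `e`. The remaining case, `ε
= 0` and `c = 0`, is a genuine collision, solved by inverting the travel time
(`exists_flowsTo_radial`).

A colliding solution is itself radial, because `x² V(x) → 0` forbids collisions with nonzero angular
momentum. In `IsTransmissionSolution.flowTendsto_collision` the exit state is compared with the
reference trajectory carried from `e` to `e'` by an isometry, then followed by continuous
dependence; the small error in direction and the small time delay are absorbed at the end. A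
supremum argument along `[0, T]` (`IsTransmissionSolution.flowTendsto`) handles any succession of
collisions, and `IsTransmissionSolution.eq_of_eq` makes the flow single-valued. -/

noncomputable section

namespace OneCentre

/-! ### Autonomous differential equations: existence, uniqueness, continuous dependence, exit from
compact sets. -/

section ODE

variable {E : Type*} [NormedAddCommGroup E] [NormedSpace ℝ E]

/-- `γ` is a solution on `[a, b]` of the autonomous equation `γ' = f γ`. -/
def IsCurve (f : E → E) (a b : ℝ) (γ : ℝ → E) : Prop :=
  ∀ t ∈ Icc a b, HasDerivWithinAt γ (f (γ t)) (Icc a b) t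

theorem IsCurve.continuousOn {f : E → E} {a b : ℝ} {γ : ℝ → E} (h : IsCurve f a b γ) :
    ContinuousOn γ (Icc a b) := fun t ht => (h t ht).continuousWithinAt

theorem hasDerivWithinAt_Ici_of_Icc {γ : ℝ → E} {γ' : E} {a b t : ℝ} (ht : t ∈ Ico a b)
    (h : HasDerivWithinAt γ γ' (Icc a b) t) : HasDerivWithinAt γ γ' (Ici t) t :=
  (h.mono (Icc_subset_Icc_left ht.1)).mono_of_mem_nhdsWithin (Icc_mem_nhdsGE ht.2)

theorem exists_isCurve_of_lipschitz [CompleteSpace E] {F : E → E} {L C : NNReal}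
    (hL : LipschitzWith L F)
    (hC : ∀ x, ‖F x‖ ≤ C) (y : E) {T : ℝ} (hT : 0 ≤ T) :
    ∃ γ : ℝ → E, γ 0 = y ∧ IsCurve F 0 T γ := by
  -- A curve of speed at most `C` stays within `C * T` of its start, so a ball of that radius gives
  -- existence on all of `[0, T]`.
  have := (IsPicardLindelof.of_time_independent (f := F) (tmin := 0) (tmax := T)
    (t₀ := ⟨0, le_rfl, hT⟩) (x₀ := y) (a := C * ⟨T, hT⟩) (r := 0) (L := C) (K := L)
    (fun x _ => hC x) hL.lipschitzOnWith (by simp [hT]; rfl))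
  exact this.exists_eq_forall_mem_Icc_hasDerivWithinAt₀

theorem IsCurve.mono {f : E → E} {a b a' b' : ℝ} {γ : ℝ → E} (h : IsCurve f a b γ)
    (ha : a ≤ a') (hb : b' ≤ b) : IsCurve f a' b' γ := fun t ht =>
  (h t (Icc_subset_Icc ha hb ht)).mono (Icc_subset_Icc ha hb)

theorem IsCurve.congr_field {f F : E → E} {a b : ℝ} {γ : ℝ → E} (h : IsCurve F a b γ)
    (hfF : ∀ t ∈ Icc a b, F (γ t) = f (γ t)) : IsCurve f a b γ := fun t ht => by
  have := h t ht
  rwa [hfF t ht] at this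

theorem IsCurve.dist_le {F : E → E} {L : NNReal} (hL : LipschitzWith L F) {a b : ℝ}
    {γ₁ γ₂ : ℝ → E} (h₁ : IsCurve F a b γ₁) (h₂ : IsCurve F a b γ₂) :
    ∀ t ∈ Icc a b, dist (γ₁ t) (γ₂ t) ≤ dist (γ₁ a) (γ₂ a) * Real.exp (L * (t - a)) :=
  dist_le_of_trajectories_ODE (v := fun _ => F) (fun _ => hL) h₁.continuousOn
    (fun t ht => hasDerivWithinAt_Ici_of_Icc ht (h₁ t (Ico_subset_Icc_self ht))) h₂.continuousOn
    (fun t ht => hasDerivWithinAt_Ici_of_Icc ht (h₂ t (Ico_subset_Icc_self ht))) le_rfl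

variable [FiniteDimensional ℝ E]

/-- A `C¹` vector field agrees on a compact set with a bounded Lipschitz vector field. -/
theorem exists_lipschitz_extension {f : E → E} {U K : Set E} (hU : IsOpen U)
    (hf : ContDiffOn ℝ 1 f U) (hK : IsCompact K) (hKU : K ⊆ U) :
    ∃ (F : E → E) (L C : NNReal), LipschitzWith L F ∧ (∀ x, ‖F x‖ ≤ C) ∧ EqOn F f K := by
  -- Multiply `f` by a cutoff equal to `1` near `K` and supported in `K' ⊆ U`: the product is
  -- globally `C¹` with compact support, hence bounded and Lipschitz.
  obtain ⟨K', hK', hKK', hK'U⟩ := exists_compact_between hK hU hKU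
  obtain ⟨χ, h1, h0, -⟩ := exists_contMDiffMap_one_nhds_of_subset_interior (n := 1)
    (modelWithCornersSelf ℝ E) hK.isClosed hKK'
  have hχ : ContDiff ℝ 1 χ := χ.contMDiff.contDiff
  have hsupp : tsupport (fun x => χ x • f x) ⊆ K' := by
    refine closure_minimal (fun x hx => ?_) hK'.isClosed
    by_contra h
    exact hx (by simp [h0 x h])
  have hcs : HasCompactSupport (fun x => χ x • f x) :=
    HasCompactSupport.intro hK' fun x hx => by simp [h0 x hx]
  have hC : ContDiff ℝ 1 (fun x => χ x • f x) := by
    refine contDiff_iff_contDiffAt.2 fun x => ?_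
    by_cases hx : x ∈ tsupport (fun x => χ x • f x)
    · exact hχ.contDiffAt.smul (hf.contDiffAt (hU.mem_nhds (hK'U (hsupp hx))))
    · exact contDiffAt_const.congr_of_eventuallyEq (notMem_tsupport_iff_eventuallyEq.1 hx)
  obtain ⟨L, hL⟩ := hC.lipschitzWith_of_hasCompactSupport (𝕂 := ℝ) hcs one_ne_zero
  obtain ⟨C, hCb⟩ := hcs.exists_bound_of_continuous hC.continuous
  refine ⟨_, L, ⟨max C 0, le_max_right _ _⟩, hL, fun x => (hCb x).trans (le_max_left _ _), ?_⟩
  intro x hx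
  simp [h1.self_of_nhdsSet x hx]

/-- Uniqueness of solutions inside the open set where the vector field is `C¹`. -/
theorem IsCurve.eqOn {f : E → E} {U : Set E} (hU : IsOpen U) (hf : ContDiffOn ℝ 1 f U)
    {a b : ℝ} {γ₁ γ₂ : ℝ → E} (h₁ : IsCurve f a b γ₁) (h₂ : IsCurve f a b γ₂)
    (hU₁ : MapsTo γ₁ (Icc a b) U) (hU₂ : MapsTo γ₂ (Icc a b) U) (h : γ₁ a = γ₂ a) :
    EqOn γ₁ γ₂ (Icc a b) := by
  obtain ⟨F, L, C, hL, -, hF⟩ := exists_lipschitz_extension hU hf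
    ((isCompact_Icc.image_of_continuousOn h₁.continuousOn).union
      (isCompact_Icc.image_of_continuousOn h₂.continuousOn))
    (union_subset hU₁.image_subset hU₂.image_subset)
  have h₁' : IsCurve F a b γ₁ := h₁.congr_field fun t ht =>
    (hF (Or.inl (mem_image_of_mem _ ht))).symm
  have h₂' : IsCurve F a b γ₂ := h₂.congr_field fun t ht =>
    (hF (Or.inr (mem_image_of_mem _ ht))).symm
  intro t ht
  have := h₁'.dist_le hL h₂' t ht
  rw [h, dist_self, zero_mul] at this
  exact dist_le_zero.1 this

/-- Continuous dependence on the initial state along a solution defined on `[0, T]`. -/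
theorem IsCurve.exists_near {f : E → E} {U : Set E} (hU : IsOpen U) (hf : ContDiffOn ℝ 1 f U)
    {T : ℝ} (hT : 0 ≤ T) {γ : ℝ → E} (hγ : IsCurve f 0 T γ) (hγU : MapsTo γ (Icc 0 T) U)
    {κ : ℝ} (hκ : 0 < κ) :
    ∃ δ > 0, ∀ y, dist y (γ 0) < δ → ∃ γ' : ℝ → E, γ' 0 = y ∧ IsCurve f 0 T γ' ∧
      MapsTo γ' (Icc 0 T) U ∧ ∀ t ∈ Icc 0 T, dist (γ' t) (γ t) < κ := by
  have hK := isCompact_Icc.image_of_continuousOn hγ.continuousOn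
  obtain ⟨κ₀, hκ₀, hsub⟩ := hK.exists_cthickening_subset_open hU hγU.image_subset
  obtain ⟨F, L, C, hL, hC, hF⟩ := exists_lipschitz_extension hU hf (hK.cthickening (r := κ₀)) hsub
  have hγF : IsCurve F 0 T γ := hγ.congr_field fun t ht =>
    (hF (Metric.self_subset_cthickening _ (mem_image_of_mem _ ht))).symm
  -- The exponential compensates the Grönwall factor, so the curve of `F` never leaves the
  -- thickening on which `F = f`.
  refine ⟨min κ κ₀ * Real.exp (-(L * T)), by positivity, fun y hy => ?_⟩
  obtain ⟨γ', h0, hγ'⟩ := exists_isCurve_of_lipschitz hL hC y hT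
  have hd : ∀ t ∈ Icc 0 T, dist (γ' t) (γ t) < min κ κ₀ := by
    intro t ht
    calc dist (γ' t) (γ t) ≤ dist (γ' 0) (γ 0) * Real.exp (L * (t - 0)) :=
          hγ'.dist_le hL hγF t ht
      _ ≤ dist (γ' 0) (γ 0) * Real.exp (L * T) := by
          gcongr; linarith [ht.2]
      _ < min κ κ₀ * Real.exp (-(L * T)) * Real.exp (L * T) := by
          rw [h0]; gcongr
      _ = min κ κ₀ := by rw [mul_assoc, ← Real.exp_add]; simp
  have hmem : ∀ t ∈ Icc 0 T, γ' t ∈ Metric.cthickening κ₀ (γ '' Icc 0 T) := fun t ht =>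
    Metric.mem_cthickening_of_dist_le _ (γ t) _ _ (mem_image_of_mem _ ht)
      ((hd t ht).le.trans (min_le_right _ _))
  exact ⟨γ', h0, hγ'.congr_field fun t ht => hF (hmem t ht), fun t ht => hsub (hmem t ht),
    fun t ht => (hd t ht).trans_le (min_le_left _ _)⟩

/-- A solution that starts in a compact set can be continued until it leaves its interior. -/
theorem exists_isCurve_until_exit {f : E → E} {U K : Set E} (hU : IsOpen U)
    (hf : ContDiffOn ℝ 1 f U) (hK : IsCompact K) (hKU : K ⊆ U) {y : E} (hy : y ∈ K) {T : ℝ}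
    (hT : 0 ≤ T) :
    ∃ t₁ ∈ Icc 0 T, ∃ γ : ℝ → E, γ 0 = y ∧ IsCurve f 0 t₁ γ ∧ MapsTo γ (Icc 0 t₁) K ∧
      (t₁ = T ∨ γ t₁ ∉ interior K) := by
  obtain ⟨F, L, C, hL, hC, hF⟩ := exists_lipschitz_extension hU hf hK hKU
  obtain ⟨γ, h0, hγ⟩ := exists_isCurve_of_lipschitz hL hC y hT
  let A : Set ℝ := {t | t ∈ Icc 0 T ∧ MapsTo γ (Icc 0 t) K}
  have hA0 : (0 : ℝ) ∈ A := ⟨⟨le_rfl, hT⟩, fun t ht => by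
    obtain rfl : t = 0 := le_antisymm ht.2 ht.1
    rwa [h0]⟩
  have hAb : BddAbove A := ⟨T, fun t ht => ht.1.2⟩
  have hm0 : 0 ≤ sSup A := le_csSup hAb hA0
  have hmT : sSup A ≤ T := csSup_le ⟨0, hA0⟩ fun t ht => ht.1.2
  have hlt : ∀ t, 0 ≤ t → t < sSup A → γ t ∈ K := fun t ht0 ht => by
    obtain ⟨s, hs, hts⟩ := exists_lt_of_lt_csSup ⟨0, hA0⟩ ht
    exact hs.2 ⟨ht0, hts.le⟩
  have hmem : MapsTo γ (Icc 0 (sSup A)) K := by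
    intro t ht
    rcases ht.2.lt_or_eq with h | h
    · exact hlt t ht.1 h
    rcases hm0.eq_or_lt with h' | h'
    · rw [h, ← h', h0]; exact hy
    have hc : ContinuousWithinAt γ (Ico 0 (sSup A)) (sSup A) :=
      (hγ.continuousOn (sSup A) ⟨hm0, hmT⟩).mono fun s hs => ⟨hs.1, hs.2.le.trans hmT⟩
    have hcl : sSup A ∈ closure (Ico 0 (sSup A)) := by
      rw [closure_Ico h'.ne]; exact ⟨hm0, le_rfl⟩
    rw [h]
    exact hK.isClosed.closure_subset (hc.mem_closure hcl fun s hs => hlt s hs.1 hs.2)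
  refine ⟨sSup A, ⟨hm0, hmT⟩, γ, h0, (hγ.mono le_rfl hmT).congr_field fun t ht => hF (hmem ht),
    hmem, ?_⟩
  rcases hmT.eq_or_lt with h | h
  · exact Or.inl h
  refine Or.inr fun hint => ?_
  have hc : ContinuousWithinAt γ (Icc (sSup A) T) (sSup A) :=
    (hγ.continuousOn (sSup A) ⟨hm0, hmT⟩).mono (Icc_subset_Icc_left hm0)
  have hev : ∀ᶠ t in 𝓝[≥] (sSup A), γ t ∈ K := by
    rw [← nhdsWithin_Icc_eq_nhdsGE h]
    exact (hc.eventually (isOpen_interior.mem_nhds hint)).mono fun t ht => interior_subset ht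
  -- If the point at time `sSup A` were interior, the curve would stay in `K` a little longer.
  obtain ⟨u, hu, huK⟩ := (mem_nhdsGE_iff_exists_Icc_subset).1 hev
  have hmin : min u T ∈ A := by
    refine ⟨⟨hm0.trans (le_min hu.le h.le), min_le_right _ _⟩, fun t ht => ?_⟩
    rcases le_total t (sSup A) with h' | h'
    · exact hmem ⟨ht.1, h'⟩
    · exact huK ⟨h', ht.2.trans (min_le_left _ _)⟩
  exact absurd (le_csSup hAb hmin) (not_le.2 (lt_min hu h))

end ODE

/-! ### The equations of motion as an autonomous system -/

/-- The smoothed distance `√(|u|² + ε²)`. -/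
def rho (ε : ℝ) (u : Plane) : ℝ := Real.sqrt (‖u‖ ^ 2 + ε ^ 2)

/-- The set of pairs (parameter, state) where the equation of motion is regular. -/
def regularSet : Set (ℝ × Phase) := {p | p.1 ≠ 0 ∨ p.2.1 ≠ 0}

/-- The vector field of the equations of motion, the parameter being a constant of motion. -/
def field (V : ℝ → ℝ) (p : ℝ × Phase) : ℝ × Phase :=
  (0, p.2.2, (deriv V (rho p.1 p.2.1) / rho p.1 p.2.1) • p.2.1)

theorem rho_sq (ε : ℝ) (u : Plane) : rho ε u ^ 2 = ‖u‖ ^ 2 + ε ^ 2 :=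
  Real.sq_sqrt (by positivity)

theorem rho_zero (u : Plane) : rho 0 u = ‖u‖ := by simp [rho]

theorem radicand_pos {ε : ℝ} {u : Plane} (h : ε ≠ 0 ∨ u ≠ 0) : 0 < ‖u‖ ^ 2 + ε ^ 2 := by
  rcases h with h | h
  · have := sq_pos_of_ne_zero h; positivity
  · have := norm_pos_iff.2 h; positivity

theorem rho_pos {ε : ℝ} {u : Plane} (h : ε ≠ 0 ∨ u ≠ 0) : 0 < rho ε u :=
  Real.sqrt_pos.2 (radicand_pos h)

theorem isOpen_regularSet : IsOpen regularSet := by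
  refine IsOpen.union ?_ ?_
  · exact isOpen_ne.preimage continuous_fst
  · exact isOpen_ne.preimage (continuous_fst.comp continuous_snd)

variable {V : ℝ → ℝ}

theorem hasDerivAt_of_smooth (hV : ContDiffOn ℝ ∞ V (Ioi 0)) {r : ℝ} (hr : 0 < r) :
    HasDerivAt V (deriv V r) r :=
  ((hV.contDiffAt (Ioi_mem_nhds hr)).differentiableAt (by simp)).hasDerivAt

theorem hasFDerivAt_rho {ε : ℝ} {u : Plane} (h : ε ≠ 0 ∨ u ≠ 0) :
    HasFDerivAt (fun w => rho ε w) ((1 / rho ε u) • innerSL ℝ u) u := by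
  have h1 : HasFDerivAt (fun w : Plane => ‖w‖ ^ 2 + ε ^ 2) (2 • innerSL ℝ u) u :=
    (hasStrictFDerivAt_norm_sq u).hasFDerivAt.add_const _
  convert! h1.sqrt (radicand_pos h).ne' using 1
  ext w
  simp [rho]
  ring

/-- For `ε ≠ 0` the formula also covers `u = 0`: `rho` is smooth there although the norm is not. -/
theorem force_eq (hV : ContDiffOn ℝ ∞ V (Ioi 0)) {ε : ℝ} {u : Plane} (h : ε ≠ 0 ∨ u ≠ 0) :
    force V ε u = (deriv V (rho ε u) / rho ε u) • u := by
  refine HasGradientAt.gradient ?_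
  rw [hasGradientAt_iff_hasFDerivAt]
  convert! (hasDerivAt_of_smooth hV (rho_pos h)).comp_hasFDerivAt u (hasFDerivAt_rho h) using 1
  ext w
  simp
  ring

theorem contDiffOn_field (hV : ContDiffOn ℝ ∞ V (Ioi 0)) :
    ContDiffOn ℝ 1 (field V) regularSet := by
  have hd : ContDiffOn ℝ 1 (deriv V) (Ioi 0) := hV.deriv_of_isOpen isOpen_Ioi (by decide)
  have hr : ContDiffOn ℝ 1 (fun p : ℝ × Phase => rho p.1 p.2.1) regularSet := by
    refine ContDiffOn.sqrt (ContDiff.contDiffOn ?_) fun p hp => (radicand_pos hp).ne'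
    exact ((contDiff_norm_sq ℝ).comp (contDiff_fst.comp contDiff_snd)).add (contDiff_fst.pow 2)
  have hd' : ContDiffOn ℝ 1 (fun p : ℝ × Phase => deriv V (rho p.1 p.2.1)) regularSet :=
    hd.comp hr fun p hp => rho_pos hp
  refine contDiffOn_const.prodMk (ContDiffOn.prodMk ?_ ?_)
  · exact (contDiff_snd.comp contDiff_snd).contDiffOn
  · exact (hd'.div hr fun p hp => (rho_pos hp).ne').smul
      (contDiff_fst.comp contDiff_snd).contDiffOn

theorem isSolutionOn_iff (hV : ContDiffOn ℝ ∞ V (Ioi 0)) {ε : ℝ} (hε : 0 ≤ ε) {a b : ℝ}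
    {x v : ℝ → Plane} :
    IsSolutionOn V ε (Icc a b) x v ↔ IsCurve (field V) a b (fun t => (ε, x t, v t)) ∧
      MapsTo (fun t => ((ε, x t, v t) : ℝ × Phase)) (Icc a b) regularSet := by
  have key : ∀ t, (0 < ε ∨ x t ≠ 0) ↔ ((ε, x t, v t) : ℝ × Phase) ∈ regularSet := fun t => by
    simp [regularSet, hε.lt_iff_ne']
  constructor
  · intro h
    refine ⟨fun t ht => ?_, fun t ht => (key t).1 (h t ht).1⟩
    obtain ⟨h1, h2, h3⟩ := h t ht
    rw [force_eq hV ((key t).1 h1)] at h3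
    exact (hasDerivWithinAt_const _ _ _).prodMk (h2.prodMk h3)
  · rintro ⟨h, hm⟩ t ht
    have h1 := h t ht
    have h2 : HasDerivWithinAt x (v t) (Icc a b) t :=
      h1.hasFDerivWithinAt.snd.fst.hasDerivWithinAt.congr_deriv (by simp [field])
    have h3 := h1.hasFDerivWithinAt.snd.snd.hasDerivWithinAt
    refine ⟨(key t).2 (hm ht), h2, ?_⟩
    rw [force_eq hV (hm ht)]
    exact h3.congr_deriv (by simp [field])

theorem IsSolutionOn.mono {ε : ℝ} {J J' : Set ℝ} {x v : ℝ → Plane}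
    (h : IsSolutionOn V ε J x v) (hJ : J' ⊆ J) : IsSolutionOn V ε J' x v := fun t ht =>
  ⟨(h t (hJ ht)).1, (h t (hJ ht)).2.1.mono hJ, (h t (hJ ht)).2.2.mono hJ⟩

theorem hasDerivWithinAt_comp_add {E : Type*} [NormedAddCommGroup E] [NormedSpace ℝ E]
    {x : ℝ → E} {x' : E} {J J' : Set ℝ} (c : ℝ) {t : ℝ} (h : HasDerivWithinAt x x' J (t + c))
    (hJ : ∀ s ∈ J', s + c ∈ J) : HasDerivWithinAt (fun s => x (s + c)) x' J' t := by
  simpa using! HasDerivWithinAt.scomp t h ((hasDerivWithinAt_id t J').add_const c) hJ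

theorem IsSolutionOn.comp_add {ε : ℝ} {J J' : Set ℝ} {x v : ℝ → Plane}
    (h : IsSolutionOn V ε J x v) (c : ℝ) (hJ : ∀ s ∈ J', s + c ∈ J) :
    IsSolutionOn V ε J' (fun t => x (t + c)) (fun t => v (t + c)) := fun t ht =>
  ⟨(h _ (hJ t ht)).1, hasDerivWithinAt_comp_add c (h _ (hJ t ht)).2.1 hJ,
    hasDerivWithinAt_comp_add c (h _ (hJ t ht)).2.2 hJ⟩

/-- A solution without collisions determines the flow. -/
theorem IsSolutionOn.flowsTo {ε : ℝ} (hε : 0 ≤ ε) {T : ℝ} (hT : 0 ≤ T) {x v : ℝ → Plane}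
    (h : IsSolutionOn V ε (Icc 0 T) x v) : FlowsTo V T (x 0, v 0) ε (x T, v T) := by
  refine ⟨x, v, rfl, rfl, ?_⟩
  rcases hε.eq_or_lt with rfl | hε'
  · have hne : ∀ t ∈ Icc 0 T, x t ≠ 0 := fun t ht => by simpa using (h t ht).1
    exact Or.inr ⟨rfl, hne 0 ⟨le_rfl, hT⟩, hne T ⟨hT, le_rfl⟩,
      fun t ht => (h t ht).2.1.continuousWithinAt, fun t ht _ => (h t ht).2,
      fun τ hτ h0 => absurd h0 (hne τ hτ)⟩
  · exact Or.inl ⟨hε', h⟩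

theorem rho_map (L : Plane ≃ₗᵢ[ℝ] Plane) (ε : ℝ) (u : Plane) : rho ε (L u) = rho ε u := by
  simp [rho]

/-- Equivariance under linear isometries. -/
theorem IsSolutionOn.map (hV : ContDiffOn ℝ ∞ V (Ioi 0)) {ε : ℝ} {J : Set ℝ} {x v : ℝ → Plane}
    (h : IsSolutionOn V ε J x v) (L : Plane ≃ₗᵢ[ℝ] Plane) :
    IsSolutionOn V ε J (fun t => L (x t)) (fun t => L (v t)) := by
  intro t ht
  obtain ⟨h1, h2, h3⟩ := h t ht
  have h1' : 0 < ε ∨ L (x t) ≠ 0 := by simpa using h1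
  have h4 : L (force V ε (x t)) = force V ε (L (x t)) := by
    rw [force_eq hV (h1.imp_left ne_of_gt), force_eq hV (h1'.imp_left ne_of_gt), rho_map, map_smul]
  refine ⟨h1', L.toContinuousLinearEquiv.hasFDerivAt.comp_hasDerivWithinAt t h2, ?_⟩
  rw [← h4]
  exact L.toContinuousLinearEquiv.hasFDerivAt.comp_hasDerivWithinAt t h3

/-! ### Concatenation of trajectories -/

section Glue

variable {E : Type*}

/-- The path `x₁` followed by `x₂` from time `T₁` on. -/
def glue {E : Type*} (T₁ : ℝ) (x₁ x₂ : ℝ → E) (t : ℝ) : E := if t ≤ T₁ then x₁ t else x₂ (t - T₁)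

variable {T₁ T₂ : ℝ} {x₁ x₂ : ℝ → E}

theorem glue_of_le {t : ℝ} (h : t ≤ T₁) : glue T₁ x₁ x₂ t = x₁ t := if_pos h

theorem glue_of_ge (h0 : x₁ T₁ = x₂ 0) {t : ℝ} (h : T₁ ≤ t) :
    glue T₁ x₁ x₂ t = x₂ (t - T₁) := by
  rcases h.eq_or_lt with rfl | h
  · simp [glue, h0]
  · exact if_neg (not_le.2 h)

theorem continuousOn_glue [TopologicalSpace E] (h0 : x₁ T₁ = x₂ 0)
    (h₁ : ContinuousOn x₁ (Icc 0 T₁)) (h₂ : ContinuousOn x₂ (Icc 0 T₂)) :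
    ContinuousOn (glue T₁ x₁ x₂) (Icc 0 (T₁ + T₂)) := by
  have hl : ContinuousOn (glue T₁ x₁ x₂) (Icc 0 T₁) :=
    h₁.congr fun _ hs => glue_of_le hs.2
  have hr : ContinuousOn (glue T₁ x₁ x₂) (Icc T₁ (T₁ + T₂)) := by
    refine (h₂.comp (f := fun t => t - T₁) (by fun_prop) fun t ht => ?_).congr
      fun t ht => glue_of_ge h0 ht.1
    exact ⟨by linarith [ht.1], by linarith [ht.2]⟩
  refine (hl.union_of_isClosed hr isClosed_Icc isClosed_Icc).mono fun t ht => ?_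
  rcases le_total t T₁ with h | h
  · exact Or.inl ⟨ht.1, h⟩
  · exact Or.inr ⟨h, ht.2⟩

variable [NormedAddCommGroup E] [NormedSpace ℝ E]

theorem hasDerivWithinAt_glue_left {d : E} {t : ℝ} (ht : t ∈ Icc 0 T₁)
    (h : HasDerivWithinAt x₁ d (Icc 0 T₁) t) :
    HasDerivWithinAt (glue T₁ x₁ x₂) d (Icc 0 T₁) t :=
  h.congr (fun _ hs => glue_of_le hs.2) (glue_of_le ht.2)

theorem hasDerivWithinAt_glue_right (h0 : x₁ T₁ = x₂ 0) {d : E} {t : ℝ}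
    (ht : t ∈ Icc T₁ (T₁ + T₂)) (h : HasDerivWithinAt x₂ d (Icc 0 T₂) (t - T₁)) :
    HasDerivWithinAt (glue T₁ x₁ x₂) d (Icc T₁ (T₁ + T₂)) t := by
  refine (hasDerivWithinAt_comp_add (J := Icc 0 T₂) (-T₁) h fun s hs => ?_).congr
    (fun s hs => glue_of_ge h0 hs.1) (glue_of_ge h0 ht.1)
  exact ⟨by linarith [hs.1], by linarith [hs.2]⟩

theorem hasDerivWithinAt_glue (hT₁ : 0 ≤ T₁) (hT₂ : 0 ≤ T₂) (h0 : x₁ T₁ = x₂ 0) {d : E} {t : ℝ}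
    (ht : t ∈ Icc 0 (T₁ + T₂)) (h₁ : t ≤ T₁ → HasDerivWithinAt x₁ d (Icc 0 T₁) t)
    (h₂ : T₁ ≤ t → HasDerivWithinAt x₂ d (Icc 0 T₂) (t - T₁)) :
    HasDerivWithinAt (glue T₁ x₁ x₂) d (Icc 0 (T₁ + T₂)) t := by
  rcases lt_trichotomy t T₁ with h | h | h
  · refine (hasDerivWithinAt_glue_left ⟨ht.1, h.le⟩ (h₁ h.le)).mono_of_mem_nhdsWithin ?_
    filter_upwards [self_mem_nhdsWithin, mem_nhdsWithin_of_mem_nhds (Iio_mem_nhds h)] with s hs hs'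
      using ⟨hs.1, le_of_lt hs'⟩
  · rw [← Icc_union_Icc_eq_Icc hT₁ (le_add_of_nonneg_right hT₂)]
    exact (hasDerivWithinAt_glue_left ⟨ht.1, h.le⟩ (h₁ h.le)).union
      (hasDerivWithinAt_glue_right h0 ⟨h.ge, ht.2⟩ (h₂ h.ge))
  · refine (hasDerivWithinAt_glue_right h0 ⟨h.le, ht.2⟩ (h₂ h.le)).mono_of_mem_nhdsWithin ?_
    filter_upwards [self_mem_nhdsWithin, mem_nhdsWithin_of_mem_nhds (Ioi_mem_nhds h)] with s hs hs'
      using ⟨le_of_lt hs', hs.2⟩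

end Glue

/-- The junction time is not a collision, by `end_ne`, so every collision lies strictly inside one
piece and its symmetric neighbourhood can be shrunk into that piece. -/
theorem IsTransmissionSolution.glue {T₁ T₂ : ℝ} (hT₁ : 0 ≤ T₁) (hT₂ : 0 ≤ T₂)
    {x₁ v₁ x₂ v₂ : ℝ → Plane}
    (hx : x₁ T₁ = x₂ 0) (hv : v₁ T₁ = v₂ 0) (h₁ : IsTransmissionSolution V T₁ x₁ v₁)
    (h₂ : IsTransmissionSolution V T₂ x₂ v₂) :
    IsTransmissionSolution V (T₁ + T₂) (glue T₁ x₁ x₂) (glue T₁ v₁ v₂) where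
  start_ne := by rw [glue_of_le hT₁]; exact h₁.start_ne
  end_ne := by rw [glue_of_ge hx (by linarith), add_sub_cancel_left]; exact h₂.end_ne
  continuousOn := continuousOn_glue hx h₁.continuousOn h₂.continuousOn
  motion t ht hne := by
    have hl : t ≤ T₁ → t ∈ Icc 0 T₁ := fun h => ⟨ht.1, h⟩
    have hr : T₁ ≤ t → t - T₁ ∈ Icc 0 T₂ := fun h => ⟨by linarith, by linarith [ht.2]⟩
    constructor
    · refine hasDerivWithinAt_glue hT₁ hT₂ hx ht (fun h => ?_) fun h => ?_
      · rw [glue_of_le h] at hne ⊢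
        exact (h₁.motion t (hl h) hne).1
      · rw [glue_of_ge hx h] at hne
        rw [glue_of_ge hv h]
        exact (h₂.motion _ (hr h) hne).1
    · refine hasDerivWithinAt_glue hT₁ hT₂ hv ht (fun h => ?_) fun h => ?_
      · rw [glue_of_le h] at hne ⊢
        exact (h₁.motion t (hl h) hne).2
      · rw [glue_of_ge hx h] at hne ⊢
        exact (h₂.motion _ (hr h) hne).2
  transmission τ hτ h0 := by
    rcases lt_trichotomy τ T₁ with h | h | h
    · rw [glue_of_le h.le] at h0
      filter_upwards [h₁.transmission τ ⟨hτ.1, h.le⟩ h0, self_mem_nhdsWithin,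
        mem_nhdsWithin_of_mem_nhds (Iio_mem_nhds (sub_pos.2 h))] with s hs hs0 hs1
      have h2 : τ - s ≤ T₁ := by linarith [mem_Ioi.1 hs0]
      have h3 : τ + s ≤ T₁ := by linarith [mem_Iio.1 hs1]
      simpa only [glue_of_le h2, glue_of_le h3] using hs
    · rw [glue_of_le h.le, h] at h0
      exact absurd h0 h₁.end_ne
    · rw [glue_of_ge hx h.le] at h0
      filter_upwards [h₂.transmission (τ - T₁) ⟨by linarith, by linarith [hτ.2]⟩ h0,
        self_mem_nhdsWithin,
        mem_nhdsWithin_of_mem_nhds (Iio_mem_nhds (sub_pos.2 h))] with s hs hs0 hs1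
      have h2 : T₁ ≤ τ - s := by linarith [mem_Iio.1 hs1]
      have h3 : T₁ ≤ τ + s := by linarith [mem_Ioi.1 hs0]
      rw [glue_of_ge hx h2, glue_of_ge hx h3, glue_of_ge hv h2, glue_of_ge hv h3,
        sub_right_comm, add_sub_right_comm]
      exact hs

theorem FlowsTo.trans {T₁ T₂ : ℝ} (hT₁ : 0 ≤ T₁) (hT₂ : 0 ≤ T₂) {y z w : Phase} {ε : ℝ}
    (h₁ : FlowsTo V T₁ y ε z) (h₂ : FlowsTo V T₂ z ε w) : FlowsTo V (T₁ + T₂) y ε w := by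
  obtain ⟨x₁, v₁, rfl, rfl, h₁⟩ := h₁
  obtain ⟨x₂, v₂, h, rfl, h₂⟩ := h₂
  obtain ⟨hx, hv⟩ := Prod.mk.inj h.symm
  have hT : T₁ ≤ T₁ + T₂ := le_add_of_nonneg_right hT₂
  refine ⟨OneCentre.glue T₁ x₁ x₂, OneCentre.glue T₁ v₁ v₂, ?_, ?_, ?_⟩
  · rw [glue_of_le hT₁, glue_of_le hT₁]
  · rw [glue_of_ge hx hT, glue_of_ge hv hT, add_sub_cancel_left]
  rcases h₁ with ⟨hε, h₁⟩ | ⟨hε, h₁⟩ <;> rcases h₂ with ⟨hε', h₂⟩ | ⟨hε', h₂⟩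
  · refine Or.inl ⟨hε, fun t ht => ⟨Or.inl hε, ?_, ?_⟩⟩
    · refine hasDerivWithinAt_glue hT₁ hT₂ hx ht (fun h => ?_) fun h => ?_
      · rw [glue_of_le h]
        exact (h₁ t ⟨ht.1, h⟩).2.1
      · rw [glue_of_ge hv h]
        exact (h₂ _ ⟨by linarith, by linarith [ht.2]⟩).2.1
    · refine hasDerivWithinAt_glue hT₁ hT₂ hv ht (fun h => ?_) fun h => ?_
      · rw [glue_of_le h]
        exact (h₁ t ⟨ht.1, h⟩).2.2
      · rw [glue_of_ge hx h]
        exact (h₂ _ ⟨by linarith, by linarith [ht.2]⟩).2.2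
  · exact absurd hε' hε.ne'
  · exact absurd hε hε'.ne'
  · exact Or.inr ⟨hε, h₁.glue hT₁ hT₂ hx hv h₂⟩

/-! ### Uniqueness of the flow -/

theorem IsSolutionOn.eq_of_eq (hV : ContDiffOn ℝ ∞ V (Ioi 0)) {ε : ℝ} (hε : 0 ≤ ε) {a b : ℝ}
    {x₁ v₁ x₂ v₂ : ℝ → Plane} (h₁ : IsSolutionOn V ε (Icc a b) x₁ v₁)
    (h₂ : IsSolutionOn V ε (Icc a b) x₂ v₂) (hx : x₁ a = x₂ a) (hv : v₁ a = v₂ a) {t : ℝ}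
    (ht : t ∈ Icc a b) : x₁ t = x₂ t ∧ v₁ t = v₂ t := by
  rw [isSolutionOn_iff hV hε] at h₁ h₂
  have := h₁.1.eqOn isOpen_regularSet (contDiffOn_field hV) h₂.1 h₁.2 h₂.2
    (by simp only [hx, hv]) ht
  simpa using this

/-- Agreement propagates past a regular time by uniqueness for the equation, and past a collision
because reflection determines the future from the past. Velocities are compared only where `x₁ t ≠
0`, since the value of `v` at a collision is unconstrained. -/
theorem IsTransmissionSolution.eq_of_eq (hV : ContDiffOn ℝ ∞ V (Ioi 0)) {T : ℝ} (hT : 0 ≤ T)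
    {x₁ v₁ x₂ v₂ : ℝ → Plane} (h₁ : IsTransmissionSolution V T x₁ v₁)
    (h₂ : IsTransmissionSolution V T x₂ v₂) (hx : x₁ 0 = x₂ 0) (hv : v₁ 0 = v₂ 0) :
    x₁ T = x₂ T ∧ v₁ T = v₂ T := by
  let P : ℝ → Prop := fun t => x₁ t = x₂ t ∧ (x₁ t ≠ 0 → v₁ t = v₂ t)
  let A : Set ℝ := {t | t ∈ Icc 0 T ∧ ∀ s ∈ Icc 0 t, P s}
  have hA0 : (0 : ℝ) ∈ A := ⟨⟨le_rfl, hT⟩, fun s hs => by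
    obtain rfl : s = 0 := le_antisymm hs.2 hs.1
    exact ⟨hx, fun _ => hv⟩⟩
  have hAb : BddAbove A := ⟨T, fun t ht => ht.1.2⟩
  obtain ⟨m, hm⟩ : ∃ m, m = sSup A := ⟨_, rfl⟩
  have hm0 : 0 ≤ m := hm ▸ le_csSup hAb hA0
  have hmT : m ≤ T := hm ▸ csSup_le ⟨0, hA0⟩ fun t ht => ht.1.2
  have hlt : ∀ t, 0 ≤ t → t < m → P t := fun t ht0 ht => by
    obtain ⟨s, hs, hts⟩ := exists_lt_of_lt_csSup ⟨0, hA0⟩ (hm ▸ ht)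
    exact hs.2 t ⟨ht0, hts.le⟩
  -- Agreement passes to the supremum by left limits: of the position always, of the velocity when
  -- `m` is not a collision.
  have hPm : P m := by
    rcases hm0.eq_or_lt with h | h
    · rw [← h]; exact ⟨hx, fun _ => hv⟩
    have hne : (𝓝[Ico 0 m] m).NeBot := by
      rw [← mem_closure_iff_nhdsWithin_neBot, closure_Ico h.ne]
      exact ⟨hm0, le_rfl⟩
    have hsub : Ico 0 m ⊆ Icc 0 T := fun s hs => ⟨hs.1, hs.2.le.trans hmT⟩
    have hxx : x₁ m = x₂ m := by
      refine tendsto_nhds_unique_of_eventuallyEq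
        ((h₁.continuousOn m ⟨hm0, hmT⟩).mono hsub) ((h₂.continuousOn m ⟨hm0, hmT⟩).mono hsub) ?_
      filter_upwards [self_mem_nhdsWithin] with s hs using (hlt s hs.1 hs.2).1
    refine ⟨hxx, fun h0 => ?_⟩
    have hne0 : ∀ᶠ s in 𝓝[Ico 0 m] m, x₁ s ≠ 0 :=
      ((h₁.continuousOn m ⟨hm0, hmT⟩).mono hsub).eventually_ne h0
    refine tendsto_nhds_unique_of_eventuallyEq
      ((h₁.motion m ⟨hm0, hmT⟩ h0).2.continuousWithinAt.mono hsub)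
      ((h₂.motion m ⟨hm0, hmT⟩ (hxx ▸ h0)).2.continuousWithinAt.mono hsub) ?_
    filter_upwards [self_mem_nhdsWithin, hne0] with s hs hs0 using (hlt s hs.1 hs.2).2 hs0
  have hmem : ∀ u, m < u → u ≤ T → (∀ s ∈ Ioc m u, P s) → False := fun u hu huT h => by
    have : u ∈ A := ⟨⟨hm0.trans hu.le, huT⟩, fun s hs => by
      rcases lt_trichotomy s m with h' | h' | h'
      · exact hlt s hs.1 h'
      · exact h' ▸ hPm
      · exact h s ⟨h', hs.2⟩⟩
    exact absurd (hm ▸ le_csSup hAb this) (not_le.2 hu)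
  rcases hmT.eq_or_lt with h | h
  · exact h ▸ ⟨hPm.1, hPm.2 (h ▸ h₁.end_ne)⟩
  exfalso
  by_cases h0 : x₁ m = 0
  · have hmpos : 0 < m := hm0.lt_of_ne fun h' => h₁.start_ne (h' ▸ h0)
    have hev := (h₁.transmission m ⟨hm0, hmT⟩ h0).and (h₂.transmission m ⟨hm0, hmT⟩ (hPm.1 ▸ h0))
    obtain ⟨u, hu, hsub⟩ := (mem_nhdsGT_iff_exists_Ioc_subset).1 hev
    have hu' : 0 < min u (min m (T - m)) := lt_min hu (lt_min hmpos (sub_pos.2 h))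
    refine hmem (m + min u (min m (T - m))) (lt_add_of_pos_right _ hu') ?_ fun s hs => ?_
    · linarith [(min_le_right u (min m (T - m))).trans (min_le_right _ _)]
    have hs1 : s - m ≤ u := by linarith [hs.2, min_le_left u (min m (T - m))]
    have hs2 : s - m ≤ m := by
      linarith [hs.2, (min_le_right u (min m (T - m))).trans (min_le_left _ _)]
    obtain ⟨⟨a1, a2, a3⟩, b1, b2, b3⟩ := hsub ⟨sub_pos.2 hs.1, hs1⟩
    rw [add_sub_cancel] at a2 a3 b2 b3
    obtain ⟨c1, c2⟩ := hlt (m - (s - m)) (by linarith) (by linarith [hs.1])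
    exact ⟨by rw [a2, b2, c1], fun _ => by rw [a3, b3, c2 a1]⟩
  · have h0' : x₂ m ≠ 0 := hPm.1 ▸ h0
    have hsub : Icc m T ⊆ Icc 0 T := Icc_subset_Icc_left hm0
    have hev := (((h₁.continuousOn m ⟨hm0, hmT⟩).mono hsub).eventually_ne h0).and
      (((h₂.continuousOn m ⟨hm0, hmT⟩).mono hsub).eventually_ne h0')
    rw [nhdsWithin_Icc_eq_nhdsGE h] at hev
    obtain ⟨u, hu, hsub'⟩ := (mem_nhdsGE_iff_exists_Icc_subset).1 hev
    have hJ : Icc m (min u T) ⊆ Icc 0 T := fun s hs => ⟨hm0.trans hs.1, hs.2.trans (min_le_right _ _)⟩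
    have hJ' : ∀ s ∈ Icc m (min u T), x₁ s ≠ 0 ∧ x₂ s ≠ 0 := fun s hs =>
      hsub' ⟨hs.1, hs.2.trans (min_le_left _ _)⟩
    have s₁ : IsSolutionOn V 0 (Icc m (min u T)) x₁ v₁ := fun s hs =>
      ⟨Or.inr (hJ' s hs).1, (h₁.motion s (hJ hs) (hJ' s hs).1).1.mono hJ,
        (h₁.motion s (hJ hs) (hJ' s hs).1).2.mono hJ⟩
    have s₂ : IsSolutionOn V 0 (Icc m (min u T)) x₂ v₂ := fun s hs =>
      ⟨Or.inr (hJ' s hs).2, (h₂.motion s (hJ hs) (hJ' s hs).2).1.mono hJ,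
        (h₂.motion s (hJ hs) (hJ' s hs).2).2.mono hJ⟩
    refine hmem (min u T) (lt_min hu h) (min_le_right _ _) fun s hs => ?_
    have := s₁.eq_of_eq hV le_rfl s₂ hPm.1 (hPm.2 h0) (Ioc_subset_Icc_self hs)
    exact ⟨this.1, fun _ => this.2⟩

theorem FlowsTo.unique (hV : ContDiffOn ℝ ∞ V (Ioi 0)) {T : ℝ} (hT : 0 ≤ T) {y z z' : Phase}
    {ε : ℝ} (h : FlowsTo V T y ε z) (h' : FlowsTo V T y ε z') : z = z' := by
  obtain ⟨x₁, v₁, rfl, rfl, h₁⟩ := h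
  obtain ⟨x₂, v₂, h0, rfl, h₂⟩ := h'
  obtain ⟨hx, hv⟩ := Prod.mk.inj h0.symm
  rcases h₁ with ⟨hε, h₁⟩ | ⟨hε, h₁⟩ <;> rcases h₂ with ⟨hε', h₂⟩ | ⟨hε', h₂⟩
  · have := h₁.eq_of_eq hV hε.le h₂ hx hv ⟨hT, le_rfl⟩
    rw [this.1, this.2]
  · exact absurd hε' hε.ne'
  · exact absurd hε hε'.ne'
  · have := h₁.eq_of_eq hV hT h₂ hx hv
    rw [this.1, this.2]

/-! ### Continuity of the flow map -/

/-- The flow map of time `T` is defined near `(y, 0)`, `ε ≥ 0`, and tends to `z` there. -/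
def FlowTendsto (V : ℝ → ℝ) (T : ℝ) (y z : Phase) : Prop :=
  ∀ W ∈ 𝓝 z, ∀ᶠ p : Phase × ℝ in 𝓝[{p | 0 ≤ p.2}] (y, 0), ∃ z' ∈ W, FlowsTo V T p.1 p.2 z'

theorem eventually_nhdsWithin_iff_dist {y : Phase} {P : Phase × ℝ → Prop} :
    (∀ᶠ p in 𝓝[{p | 0 ≤ p.2}] (y, (0 : ℝ)), P p) ↔
      ∃ δ > 0, ∀ y' ε, dist y' y < δ → 0 ≤ ε → ε < δ → P (y', ε) := by
  rw [Metric.nhdsWithin_basis_ball.eventually_iff]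
  refine exists_congr fun δ => and_congr_right fun hδ => ?_
  constructor
  · intro h y' ε h1 h2 h3
    refine h ⟨?_, h2⟩
    rw [Metric.mem_ball, Prod.dist_eq, max_lt_iff]
    exact ⟨h1, by rwa [Real.dist_eq, sub_zero, abs_of_nonneg h2]⟩
  · rintro h ⟨y', ε⟩ ⟨h1, h2⟩
    rw [Metric.mem_ball, Prod.dist_eq, max_lt_iff, Real.dist_eq, sub_zero] at h1
    exact h y' ε h1.1 h2 ((le_abs_self _).trans_lt h1.2)

/-- Existence and convergence are carried together, at the same `ε`, so the intermediate state can
serve as a new initial state. -/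
theorem FlowTendsto.trans {T₁ T₂ : ℝ} (hT₁ : 0 ≤ T₁) (hT₂ : 0 ≤ T₂) {y z w : Phase}
    (h₁ : FlowTendsto V T₁ y z) (h₂ : FlowTendsto V T₂ z w) : FlowTendsto V (T₁ + T₂) y w := by
  intro W hW
  obtain ⟨δ, hδ, h⟩ := eventually_nhdsWithin_iff_dist.1 (h₂ W hW)
  obtain ⟨δ', hδ', h'⟩ := eventually_nhdsWithin_iff_dist.1 (h₁ _ (Metric.ball_mem_nhds z hδ))
  refine eventually_nhdsWithin_iff_dist.2 ⟨min δ δ', lt_min hδ hδ', fun y' ε hy hε hε' => ?_⟩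
  obtain ⟨z', hz', hf⟩ := h' y' ε (hy.trans_le (min_le_right _ _)) hε
    (hε'.trans_le (min_le_right _ _))
  obtain ⟨w', hw', hg⟩ := h z' ε hz' hε (hε'.trans_le (min_le_left _ _))
  exact ⟨w', hw', hf.trans hT₁ hT₂ hg⟩

theorem eq_left_of_hasDerivWithinAt_zero {F : Type*} [NormedAddCommGroup F] [NormedSpace ℝ F]
    {f : ℝ → F} {a b : ℝ} (h : ∀ t ∈ Icc a b, HasDerivWithinAt f 0 (Icc a b) t) :
    ∀ t ∈ Icc a b, f t = f a :=
  constant_of_has_deriv_right_zero (fun t ht => (h t ht).continuousWithinAt) fun t ht =>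
    hasDerivWithinAt_Ici_of_Icc ht (h t (Ico_subset_Icc_self ht))

theorem IsCurve.isSolutionOn (hV : ContDiffOn ℝ ∞ V (Ioi 0)) {ε T : ℝ} (hε : 0 ≤ ε)
    {γ : ℝ → ℝ × Phase} (h : IsCurve (field V) 0 T γ) (hm : MapsTo γ (Icc 0 T) regularSet)
    (h0 : (γ 0).1 = ε) :
    (∀ t ∈ Icc 0 T, (γ t).1 = ε) ∧
      IsSolutionOn V ε (Icc 0 T) (fun t => (γ t).2.1) (fun t => (γ t).2.2) := by
  have hc : ∀ t ∈ Icc 0 T, (γ t).1 = ε := fun t ht => by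
    rw [← h0]
    refine eq_left_of_hasDerivWithinAt_zero (f := fun t => (γ t).1) (fun s hs => ?_) t ht
    exact (h s hs).hasFDerivWithinAt.fst.hasDerivWithinAt.congr_deriv (by simp [field])
  have he : ∀ t ∈ Icc 0 T, (ε, (γ t).2.1, (γ t).2.2) = γ t := fun t ht => by rw [← hc t ht]
  refine ⟨hc, (isSolutionOn_iff hV hε).2 ⟨fun t ht => ?_, fun t ht => ?_⟩⟩
  · simp only [he t ht]
    exact (h t ht).congr he (he t ht)
  · simp only [he t ht]
    exact hm ht

theorem IsSolutionOn.exists_near (hV : ContDiffOn ℝ ∞ V (Ioi 0)) {a b : ℝ} (hab : a ≤ b)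
    {x v : ℝ → Plane} (h : IsSolutionOn V 0 (Icc a b) x v) {κ : ℝ} (hκ : 0 < κ) :
    ∃ δ > 0, ∀ (y : Phase) (ε : ℝ), dist y (x a, v a) < δ → 0 ≤ ε → ε < δ →
      ∃ x' v' : ℝ → Plane, (x' 0, v' 0) = y ∧ IsSolutionOn V ε (Icc 0 (b - a)) x' v' ∧
        ∀ t ∈ Icc 0 (b - a), dist (x' t, v' t) (x (t + a), v (t + a)) < κ := by
  have h' : IsSolutionOn V 0 (Icc 0 (b - a)) (fun t => x (t + a)) (fun t => v (t + a)) :=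
    h.comp_add a fun s hs => ⟨by linarith [hs.1], by linarith [hs.2]⟩
  obtain ⟨hc, hm⟩ := (isSolutionOn_iff hV le_rfl).1 h'
  obtain ⟨δ, hδ, hδ'⟩ := hc.exists_near isOpen_regularSet (contDiffOn_field hV)
    (sub_nonneg.2 hab) hm hκ
  refine ⟨δ, hδ, fun y ε hy hε hε' => ?_⟩
  obtain ⟨γ, h0, hγ, hγm, hd⟩ := hδ' (ε, y) (by
    rw [Prod.dist_eq, max_lt_iff]
    refine ⟨by simpa [abs_of_nonneg hε] using hε', by simpa using hy⟩)
  refine ⟨_, _, ?_, (hγ.isSolutionOn hV hε hγm (by rw [h0])).2, fun t ht => ?_⟩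
  · rw [h0]
  · have h2 := hd t ht
    rw [Prod.dist_eq, max_lt_iff] at h2
    exact h2.2

theorem IsSolutionOn.flowTendsto (hV : ContDiffOn ℝ ∞ V (Ioi 0)) {a b : ℝ} (hab : a ≤ b)
    {x v : ℝ → Plane} (h : IsSolutionOn V 0 (Icc a b) x v) :
    FlowTendsto V (b - a) (x a, v a) (x b, v b) := by
  intro W hW
  obtain ⟨κ, hκ, hW⟩ := Metric.mem_nhds_iff.1 hW
  obtain ⟨δ, hδ, hd⟩ := h.exists_near hV hab hκ
  refine eventually_nhdsWithin_iff_dist.2 ⟨δ, hδ, fun y ε hy hε hε' => ?_⟩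
  obtain ⟨x', v', rfl, hs, hd⟩ := hd y ε hy hε hε'
  have := hd (b - a) ⟨sub_nonneg.2 hab, le_rfl⟩
  rw [sub_add_cancel] at this
  exact ⟨_, hW this, hs.flowsTo hε (sub_nonneg.2 hab)⟩

/-! ### The potential near the singularity -/

/-- On `(0, σ]` the potential is decreasing, at least `M`, and satisfies `-x V' ≤ η V`. -/
def IsScale (V : ℝ → ℝ) (η M σ : ℝ) : Prop :=
  0 < σ ∧ ∀ x, 0 < x → x ≤ σ → M ≤ V x ∧ deriv V x < 0 ∧ -(x * deriv V x) ≤ η * V x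

theorem exists_of_eventually_nhdsGT {P : ℝ → Prop} (h : ∀ᶠ x in 𝓝[>] (0 : ℝ), P x) :
    ∃ σ > 0, ∀ x, 0 < x → x ≤ σ → P x := by
  obtain ⟨u, hu, hsub⟩ := (mem_nhdsGT_iff_exists_Ioc_subset).1 h
  exact ⟨u, hu, fun x hx hx' => hsub ⟨hx, hx'⟩⟩

theorem ClassV.eventually_deriv (hV : ClassV V) :
    ∀ᶠ x in 𝓝[>] (0 : ℝ), ∀ y, 0 < y → y ≤ x → deriv V y < 0 ∧ 0 < deriv (deriv V) y := by
  obtain ⟨S, hS, hd, -⟩ := hV.decreasingConvex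
  obtain ⟨s, hs0, hsS⟩ := EReal.lt_iff_exists_real_btwn.1 hS
  have hs : (0 : ℝ) < s := by exact_mod_cast hs0
  filter_upwards [Ioc_mem_nhdsGT hs] with x hx y hy hyx
  exact hd y hy (lt_of_le_of_lt (by exact_mod_cast hyx.trans hx.2) hsS)

/-- Convexity and slow variation give `-x V'(x) = o(V(x))`. -/
theorem ClassVStar.exists_isScale (hV : ClassVStar V) {η : ℝ} (hη : 0 < η) (M : ℝ) :
    ∃ σ, IsScale V η M σ := by
  -- Slow variation is used with ratio `2`, from `x / 2` to `x`. The bound `1 / 2` yields `V (x / 2)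
  -- ≤ 2 * V x`, and `η / 8` yields `V (x / 2) - V x ≤ η / 4 * V x`.
  have hsv := Metric.tendstoUniformlyOn_iff.1 (hV.slowlyVarying 2 one_le_two)
    (min (η / 8) (1 / 2)) (by positivity)
  have hbig := hV.singular.eventually_ge_atTop (max M 1)
  obtain ⟨σ₁, hσ₁, h₁⟩ := exists_of_eventually_nhdsGT hsv
  obtain ⟨σ₂, hσ₂, h₂⟩ := exists_of_eventually_nhdsGT hbig
  obtain ⟨σ₃, hσ₃, h₃⟩ := exists_of_eventually_nhdsGT hV.toClassV.eventually_deriv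
  refine ⟨min σ₁ (min σ₂ σ₃), by positivity, fun x hx hxσ => ?_⟩
  have hx1 : x ≤ σ₁ := hxσ.trans (min_le_left _ _)
  have hx2 : x ≤ σ₂ := hxσ.trans ((min_le_right _ _).trans (min_le_left _ _))
  have hx3 : x ≤ σ₃ := hxσ.trans ((min_le_right _ _).trans (min_le_right _ _))
  have hM := h₂ x hx hx2
  refine ⟨(le_max_left _ _).trans hM, (h₃ x hx hx3 x hx le_rfl).1, ?_⟩
  have hd : ∀ y, 0 < y → HasDerivAt V (deriv V y) y := fun y hy => hasDerivAt_of_smooth hV.smooth hy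
  have hd2 : ∀ y, 0 < y → DifferentiableAt ℝ (deriv V) y := fun y hy =>
    (((hV.smooth.deriv_of_isOpen (m := 1) isOpen_Ioi (by decide)).contDiffAt
      (Ioi_mem_nhds hy)).differentiableAt (by simp))
  have hmono : MonotoneOn (deriv V) (Icc (x / 2) x) := by
    refine monotoneOn_of_deriv_nonneg (convex_Icc _ _) (fun y hy => ?_) (fun y hy => ?_)
      fun y hy => ?_
    · exact (hd2 y (by linarith [hy.1])).continuousAt.continuousWithinAt
    · rw [interior_Icc] at hy
      exact (hd2 y (by linarith [hy.1])).differentiableWithinAt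
    · rw [interior_Icc] at hy
      exact (h₃ x hx hx3 y (by linarith [hy.1]) hy.2.le).2.le
  -- Since `V'` increases, its value at `x` is at least the slope over `[x / 2, x]`, whence `-(x *
  -- V' x) ≤ 2 * (V (x / 2) - V x)`.
  obtain ⟨ξ, hξ, hslope⟩ := exists_hasDerivAt_eq_slope V (deriv V) (a := x / 2) (b := x)
    (by linarith) (fun y hy => (hd y (by linarith [hy.1])).continuousAt.continuousWithinAt)
    fun y hy => hd y (by linarith [hy.1])
  have hξx : deriv V ξ ≤ deriv V x :=
    hmono ⟨hξ.1.le, hξ.2.le⟩ ⟨by linarith, le_rfl⟩ hξ.2.le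
  rw [hslope, div_le_iff₀ (by linarith)] at hξx
  have hM' := h₂ (x / 2) (by linarith) (by linarith)
  have hVh : 1 ≤ V (x / 2) := (le_max_right _ _).trans hM'
  have hVx : 1 ≤ V x := (le_max_right _ _).trans hM
  have hr := h₁ (x / 2) (by linarith) (by linarith) 2 ⟨one_le_two, le_rfl⟩
  rw [Real.dist_eq, div_mul_cancel₀ x two_ne_zero, lt_min_iff] at hr
  have e : V x = V x / V (x / 2) * V (x / 2) := by field_simp
  set q := V x / V (x / 2)
  have hq1 : 1 - q ≤ η / 8 := (le_abs_self _).trans hr.1.le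
  have hq2 : 1 - q ≤ 1 / 2 := (le_abs_self _).trans hr.2.le
  have h4 : V (x / 2) ≤ 2 * V x := by nlinarith
  nlinarith

theorem IsScale.antitoneOn (hV : ContDiffOn ℝ ∞ V (Ioi 0)) {η M σ : ℝ} (h : IsScale V η M σ) :
    AntitoneOn V (Ioc 0 σ) := by
  refine antitoneOn_of_deriv_nonpos (convex_Ioc _ _) (fun y hy => ?_) (fun y hy => ?_)
    fun y hy => ?_
  · exact (hasDerivAt_of_smooth hV hy.1).continuousAt.continuousWithinAt
  · rw [interior_Ioc] at hy
    exact (hasDerivAt_of_smooth hV hy.1).differentiableAt.differentiableWithinAt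
  · rw [interior_Ioc] at hy
    exact (h.2 y hy.1 hy.2.le).2.1.le

/-- For `η = 1` the scale inequality says `(x V)' = V + x V' ≥ 0`, so `x V` stays bounded near `0`.
This growth bound excludes collisions with nonzero angular momentum. -/
theorem ClassVStar.tendsto_sq_mul (hV : ClassVStar V) :
    Tendsto (fun x => x ^ 2 * V x) (𝓝[>] 0) (𝓝 0) := by
  obtain ⟨σ, hσ, h⟩ := hV.exists_isScale one_pos 0
  have hd : ∀ y, 0 < y → HasDerivAt (fun x => x * V x) (1 * V y + y * deriv V y) y := fun y hy =>
    (hasDerivAt_id y).mul (hasDerivAt_of_smooth hV.smooth hy)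
  have hmono : MonotoneOn (fun x => x * V x) (Ioc 0 σ) := by
    refine monotoneOn_of_deriv_nonneg (convex_Ioc _ _) (fun y hy => ?_) (fun y hy => ?_)
      fun y hy => ?_
    · exact (hd y hy.1).continuousAt.continuousWithinAt
    · rw [interior_Ioc] at hy
      exact (hd y hy.1).differentiableAt.differentiableWithinAt
    · rw [interior_Ioc] at hy
      rw [(hd y hy.1).deriv]
      linarith [(h y hy.1 hy.2.le).2.2]
  have hlim : Tendsto (fun x : ℝ => x * (σ * V σ)) (𝓝[>] 0) (𝓝 0) := by
    have : Tendsto (fun x : ℝ => x * (σ * V σ)) (𝓝 0) (𝓝 (0 * (σ * V σ))) :=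
      tendsto_id.mul_const _
    rw [zero_mul] at this
    exact this.mono_left nhdsWithin_le_nhds
  refine squeeze_zero' ?_ ?_ hlim
  · filter_upwards [Ioc_mem_nhdsGT hσ] with x hx
    exact mul_nonneg (sq_nonneg x) (h x hx.1 hx.2).1
  · filter_upwards [Ioc_mem_nhdsGT hσ] with x hx
    have := hmono hx ⟨hσ, le_rfl⟩ hx.2
    have h0 := hx.1
    simp only at this
    nlinarith

/-! ### Conserved quantities -/

/-- The angular momentum. -/
def ang (x v : Plane) : ℝ := x 0 * v 1 - x 1 * v 0

/-- The energy. -/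
def energy (V : ℝ → ℝ) (ε : ℝ) (x v : Plane) : ℝ := ‖v‖ ^ 2 / 2 - V (rho ε x)

theorem plane_inner (x y : Plane) : inner ℝ x y = x 0 * y 0 + x 1 * y 1 := by
  simp [PiLp.inner_apply, Fin.sum_univ_two, mul_comm]

theorem plane_norm_sq (x : Plane) : ‖x‖ ^ 2 = x 0 ^ 2 + x 1 ^ 2 := by
  rw [← real_inner_self_eq_norm_sq, plane_inner]; ring

/-- Lagrange's identity. It bounds the distance from the centre below, gives the radial part of an
exit velocity, and forces radial motion when `ang` vanishes. -/
theorem ang_sq_add_inner_sq (x v : Plane) :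
    ang x v ^ 2 + inner ℝ x v ^ 2 = ‖x‖ ^ 2 * ‖v‖ ^ 2 := by
  rw [plane_inner, plane_norm_sq, plane_norm_sq, ang]; ring

theorem continuous_ang : Continuous fun p : Phase => ang p.1 p.2 := by
  unfold ang; fun_prop

section Motion

variable {ε : ℝ} {J : Set ℝ} {x v : ℝ → Plane} {t : ℝ}

theorem hasDerivWithinAt_coord {x : ℝ → Plane} {x' : Plane} (h : HasDerivWithinAt x x' J t)
    (i : Fin 2) : HasDerivWithinAt (fun s => x s i) (x' i) J t :=
  (EuclideanSpace.proj (𝕜 := ℝ) i).hasFDerivAt.comp_hasDerivWithinAt t h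

theorem IsSolutionOn.regular (h : IsSolutionOn V ε J x v) (ht : t ∈ J) :
    ε ≠ 0 ∨ x t ≠ 0 := (h t ht).1.imp_left ne_of_gt

theorem IsSolutionOn.hasDeriv_vel (hV : ContDiffOn ℝ ∞ V (Ioi 0))
    (h : IsSolutionOn V ε J x v) (ht : t ∈ J) :
    HasDerivWithinAt v ((deriv V (rho ε (x t)) / rho ε (x t)) • x t) J t := by
  rw [← force_eq hV (h.regular ht)]
  exact (h t ht).2.2

theorem IsSolutionOn.hasDeriv_ang (hV : ContDiffOn ℝ ∞ V (Ioi 0))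
    (h : IsSolutionOn V ε J x v) (ht : t ∈ J) :
    HasDerivWithinAt (fun s => ang (x s) (v s)) 0 J t := by
  have hx := (h t ht).2.1
  have hv := h.hasDeriv_vel hV ht
  have := ((hasDerivWithinAt_coord hx 0).mul (hasDerivWithinAt_coord hv 1)).sub
    ((hasDerivWithinAt_coord hx 1).mul (hasDerivWithinAt_coord hv 0))
  exact this.congr_deriv (by simp; ring)

theorem IsSolutionOn.hasDeriv_energy (hV : ContDiffOn ℝ ∞ V (Ioi 0))
    (h : IsSolutionOn V ε J x v) (ht : t ∈ J) :
    HasDerivWithinAt (fun s => energy V ε (x s) (v s)) 0 J t := by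
  have hr := h.regular ht
  have h1 := (h.hasDeriv_vel hV ht).norm_sq.div_const 2
  have h2 := (hasFDerivAt_rho hr).comp_hasDerivWithinAt t (h t ht).2.1
  have h3 := (hasDerivAt_of_smooth hV (rho_pos hr)).comp_hasDerivWithinAt t h2
  refine (h1.sub h3).congr_deriv ?_
  simp [real_inner_smul_right, real_inner_comm]
  ring

theorem IsSolutionOn.hasDeriv_inner (hV : ContDiffOn ℝ ∞ V (Ioi 0))
    (h : IsSolutionOn V ε J x v) (ht : t ∈ J) :
    HasDerivWithinAt (fun s => inner ℝ (x s) (v s))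
      (‖v t‖ ^ 2 + deriv V (rho ε (x t)) / rho ε (x t) * ‖x t‖ ^ 2) J t := by
  refine ((h t ht).2.1.inner ℝ (h.hasDeriv_vel hV ht)).congr_deriv ?_
  rw [real_inner_smul_right, real_inner_self_eq_norm_sq, real_inner_self_eq_norm_sq, add_comm]

theorem IsSolutionOn.ang_eq (hV : ContDiffOn ℝ ∞ V (Ioi 0)) {a b : ℝ}
    (h : IsSolutionOn V ε (Icc a b) x v) (ht : t ∈ Icc a b) :
    ang (x t) (v t) = ang (x a) (v a) :=
  eq_left_of_hasDerivWithinAt_zero (f := fun s => ang (x s) (v s))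
    (fun _ hs => h.hasDeriv_ang hV hs) t ht

theorem IsSolutionOn.energy_eq (hV : ContDiffOn ℝ ∞ V (Ioi 0)) {a b : ℝ}
    (h : IsSolutionOn V ε (Icc a b) x v) (ht : t ∈ Icc a b) :
    energy V ε (x t) (v t) = energy V ε (x a) (v a) :=
  eq_left_of_hasDerivWithinAt_zero (f := fun s => energy V ε (x s) (v s))
    (fun _ hs => h.hasDeriv_energy hV hs) t ht

/-- The direction of the velocity. -/
def dir (v : Plane) : Plane := ‖v‖⁻¹ • v

theorem norm_dir {v : Plane} (h : v ≠ 0) : ‖dir v‖ = 1 := by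
  rw [dir, norm_smul, norm_inv, norm_norm, inv_mul_cancel₀ (norm_ne_zero_iff.2 h)]

theorem norm_smul_dir {v : Plane} (h : v ≠ 0) : ‖v‖ • dir v = v := by
  rw [dir, smul_smul, mul_inv_cancel₀ (norm_ne_zero_iff.2 h), one_smul]

theorem hasDerivWithinAt_dir {a : Plane} (hv : HasDerivWithinAt v a J t) (h0 : v t ≠ 0) :
    HasDerivWithinAt (fun s => dir (v s))
      ((‖v t‖ ^ 3)⁻¹ • (‖v t‖ ^ 2 • a - inner ℝ (v t) a • v t)) J t := by
  have hn : ‖v t‖ ≠ 0 := norm_ne_zero_iff.2 h0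
  have h1 : HasDerivWithinAt (fun s => ‖v s‖) (inner ℝ (v t) a / ‖v t‖) J t := by
    have := hv.norm_sq.sqrt (pow_ne_zero 2 hn)
    simp only [Real.sqrt_sq (norm_nonneg _)] at this
    exact this.congr_deriv (by field_simp)
  refine ((h1.inv hn).smul hv).congr_deriv ?_
  rw [smul_sub, smul_smul, smul_smul, sub_eq_add_neg, ← neg_smul]
  congr 2 <;> try simp only [Pi.inv_apply]
  all_goals field_simp

/-- In the plane the part of `g • x` orthogonal to `v` has length `|g * ang x v| / ‖v‖`; hence
turning is governed by angular momentum alone. -/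
theorem norm_sq_deriv_dir (v x : Plane) (g : ℝ) :
    ‖‖v‖ ^ 2 • (g • x) - inner ℝ v (g • x) • v‖ ^ 2 = (g * ‖v‖ * ang x v) ^ 2 := by
  rw [plane_norm_sq (_ - _), mul_pow, mul_pow, real_inner_smul_right, plane_inner, plane_norm_sq,
    ang]
  simp
  ring

end Motion

/-! ### The direction of the velocity is almost constant near the centre -/

/-- Put `c = ang` and `g = V'(ρ) / ρ`. The direction turns at rate `-g |c| / ‖v‖²`, while `arctan
(⟨x, v⟩ / |c|)` grows at rate `|c| (‖v‖² + g ‖x‖²) / (‖x‖² ‖v‖²)`. Since `-g ‖x‖² ≤ η ‖v‖²` and `η ≤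
1 / 2`, the first rate is at most `2η` times the second. The bound `π` on the variation of `arctan`
makes the estimate uniform in `c`, `ε` and the duration. -/
theorem IsSolutionOn.norm_dir_sub_le (hV : ContDiffOn ℝ ∞ V (Ioi 0)) {ε : ℝ}
    {T η M σ : ℝ} (hη : 0 < η) (hη' : η ≤ 1 / 2) (hM : 0 < M) (hsc : IsScale V η M σ)
    {x v : ℝ → Plane} (h : IsSolutionOn V ε (Icc 0 T) x v)
    (hσ : ∀ t ∈ Icc 0 T, rho ε (x t) ≤ σ)
    (hE : ∀ t ∈ Icc 0 T, V (rho ε (x t)) ≤ ‖v t‖ ^ 2) {t : ℝ} (ht : t ∈ Icc 0 T) :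
    ‖dir (v t) - dir (v 0)‖ ≤ 2 * Real.pi * η := by
  have hρ : ∀ t ∈ Icc 0 T, 0 < rho ε (x t) := fun t ht => rho_pos (h.regular ht)
  have hv2 : ∀ t ∈ Icc 0 T, 0 < ‖v t‖ ^ 2 := fun t ht =>
    (hM.trans_le (hsc.2 _ (hρ t ht) (hσ t ht)).1).trans_le (hE t ht)
  have hv0 : ∀ t ∈ Icc 0 T, v t ≠ 0 := fun t ht h0 => by
    have := hv2 t ht
    simp [h0] at this
  have hvn : ∀ t ∈ Icc 0 T, 0 < ‖v t‖ := fun t ht => norm_pos_iff.2 (hv0 t ht)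
  set c := ang (x 0) (v 0) with hc
  let g : ℝ → ℝ := fun t => deriv V (rho ε (x t)) / rho ε (x t)
  let n' : ℝ → Plane := fun t =>
    (‖v t‖ ^ 3)⁻¹ • (‖v t‖ ^ 2 • (g t • x t) - inner ℝ (v t) (g t • x t) • v t)
  have hn' : ∀ t ∈ Icc 0 T, HasDerivWithinAt (fun s => dir (v s)) (n' t) (Icc 0 T) t :=
    fun t ht => hasDerivWithinAt_dir (h.hasDeriv_vel hV ht) (hv0 t ht)
  have hg : ∀ t ∈ Icc 0 T, g t < 0 := fun t ht =>
    div_neg_of_neg_of_pos (hsc.2 _ (hρ t ht) (hσ t ht)).2.1 (hρ t ht)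
  have hgx : ∀ t ∈ Icc 0 T, -g t * ‖x t‖ ^ 2 ≤ η * ‖v t‖ ^ 2 := fun t ht => by
    have h1 := (hsc.2 _ (hρ t ht) (hσ t ht)).2.2
    have h2 : -(rho ε (x t) * deriv V (rho ε (x t))) = -g t * rho ε (x t) ^ 2 := by
      have := (hρ t ht).ne'
      simp only [g]; field_simp
    have h3 : ‖x t‖ ^ 2 ≤ rho ε (x t) ^ 2 := by rw [rho_sq]; nlinarith [sq_nonneg ε]
    nlinarith [hg t ht, hE t ht]
  have hnorm : ∀ t ∈ Icc 0 T, ‖n' t‖ = -g t * |c| / ‖v t‖ ^ 2 := fun t ht => by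
    have h1 := norm_sq_deriv_dir (v t) (x t) (g t)
    rw [h.ang_eq hV ht, ← hc, ← abs_of_nonneg (norm_nonneg (_ - _)), sq_eq_sq_iff_abs_eq_abs,
      abs_abs, abs_of_nonneg (norm_nonneg _), abs_mul, abs_mul, abs_of_neg (hg t ht),
      abs_of_pos (hvn t ht)] at h1
    have := (hvn t ht).ne'
    simp only [n']
    rw [norm_smul, h1, norm_inv, norm_pow, norm_norm]
    field_simp
  -- Without angular momentum the direction is constant; otherwise one may divide by `|c|`.
  by_cases hc0 : c = 0
  · have : dir (v t) = dir (v 0) := by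
      refine eq_left_of_hasDerivWithinAt_zero (f := fun s => dir (v s)) (fun s hs => ?_) t ht
      refine (hn' s hs).congr_deriv ?_
      rw [← norm_eq_zero, hnorm s hs, hc0]
      simp
    rw [this, sub_self, norm_zero]
    positivity
  have hcp : 0 < |c| := abs_pos.2 hc0
  let A : ℝ → ℝ := fun t => Real.arctan (inner ℝ (x t) (v t) / |c|)
  have hA : ∀ t ∈ Icc 0 T, HasDerivWithinAt A
      (1 / (1 + (inner ℝ (x t) (v t) / |c|) ^ 2) * ((‖v t‖ ^ 2 + g t * ‖x t‖ ^ 2) / |c|))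
      (Icc 0 T) t := fun t ht =>
    ((h.hasDeriv_inner hV ht).div_const _).arctan
  have hbound : ∀ t ∈ Icc 0 T, ‖n' t‖ ≤ 2 * η *
      (1 / (1 + (inner ℝ (x t) (v t) / |c|) ^ 2) * ((‖v t‖ ^ 2 + g t * ‖x t‖ ^ 2) / |c|)) := by
    intro t ht
    have hl := ang_sq_add_inner_sq (x t) (v t)
    rw [h.ang_eq hV ht, ← hc, ← sq_abs c] at hl
    have hx2 : 0 < ‖x t‖ ^ 2 := by
      by_contra hx
      have : ‖x t‖ ^ 2 = 0 := le_antisymm (not_lt.1 hx) (sq_nonneg _)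
      rw [this, zero_mul] at hl
      nlinarith [sq_nonneg (inner ℝ (x t) (v t) : ℝ)]
    have e : 1 / (1 + (inner ℝ (x t) (v t) / |c|) ^ 2) *
        ((‖v t‖ ^ 2 + g t * ‖x t‖ ^ 2) / |c|) =
        |c| * (‖v t‖ ^ 2 + g t * ‖x t‖ ^ 2) / (‖x t‖ ^ 2 * ‖v t‖ ^ 2) := by
      rw [← hl]
      field_simp
    rw [e, hnorm t ht, ← mul_div_assoc, div_le_div_iff₀ (hv2 t ht) (mul_pos hx2 (hv2 t ht))]
    have h1 := hgx t ht
    have h2 := hg t ht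
    have h3 : -g t * ‖x t‖ ^ 2 ≤ 2 * η * (‖v t‖ ^ 2 + g t * ‖x t‖ ^ 2) := by
      have : 0 ≤ -g t * ‖x t‖ ^ 2 := by nlinarith
      nlinarith
    have h4 := mul_le_mul_of_nonneg_left h3 (mul_nonneg hcp.le (hv2 t ht).le)
    nlinarith
  have hsub : ∀ s ∈ Ico 0 T, s ∈ Icc 0 T := fun s hs => Ico_subset_Icc_self hs
  have key := image_norm_le_of_norm_deriv_right_le_deriv_boundary'
    (f := fun s => dir (v s) - dir (v 0)) (f' := n') (a := 0) (b := T)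
    (B := fun s => 2 * η * (A s - A 0))
    (fun s hs => ((hn' s hs).continuousWithinAt.sub continuousWithinAt_const))
    (fun s hs => (hasDerivWithinAt_Ici_of_Icc hs (hn' s (hsub s hs))).sub_const _)
    (by simp)
    (fun s hs => ((hA s hs).continuousWithinAt.sub continuousWithinAt_const).const_smul (2 * η))
    (fun s hs => ((hasDerivWithinAt_Ici_of_Icc hs (hA s (hsub s hs))).sub_const _).const_mul _)
    (fun s hs => hbound s (hsub s hs)) ht
  refine key.trans ?_
  have h1 := Real.arctan_lt_pi_div_two (inner ℝ (x t) (v t) / |c|)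
  have h2 := Real.neg_pi_div_two_lt_arctan (inner ℝ (x 0) (v 0) / |c|)
  have h3 : A t - A 0 ≤ Real.pi := by simp only [A]; linarith
  nlinarith

/-! ### Radial trajectories through the centre -/

/-- The travel time per unit length of a radial trajectory of energy `E`, as a function of the
signed distance from the centre; beyond the distance `σ` it is frozen. -/
def slowness (V : ℝ → ℝ) (E σ : ℝ) : ℝ → ℝ :=
  Function.update (fun s => (Real.sqrt (2 * (E + V (min |s| σ))))⁻¹) 0 0

section Slowness

variable {E σ : ℝ}

theorem slowness_of_ne {s : ℝ} (hs : s ≠ 0) :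
    slowness V E σ s = (Real.sqrt (2 * (E + V (min |s| σ))))⁻¹ :=
  Function.update_of_ne hs _ _

theorem slowness_zero : slowness V E σ 0 = 0 := Function.update_self _ _ _

theorem slowness_neg (s : ℝ) : slowness V E σ (-s) = slowness V E σ s := by
  by_cases hs : s = 0
  · simp [hs]
  · rw [slowness_of_ne hs, slowness_of_ne (neg_ne_zero.2 hs), abs_neg]

theorem one_le_speed (hσ : 0 < σ) (hE : ∀ s, 0 < s → s ≤ σ → 1 ≤ 2 * (E + V s)) {s : ℝ}
    (hs : s ≠ 0) : 1 ≤ Real.sqrt (2 * (E + V (min |s| σ))) :=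
  Real.one_le_sqrt.2 (hE _ (lt_min (abs_pos.2 hs) hσ) (min_le_right _ _))

theorem slowness_pos (hσ : 0 < σ) (hE : ∀ s, 0 < s → s ≤ σ → 1 ≤ 2 * (E + V s)) {s : ℝ}
    (hs : s ≠ 0) : 0 < slowness V E σ s := by
  rw [slowness_of_ne hs]
  exact inv_pos.2 (one_pos.trans_le (one_le_speed hσ hE hs))

theorem slowness_le_one (hσ : 0 < σ) (hE : ∀ s, 0 < s → s ≤ σ → 1 ≤ 2 * (E + V s)) (s : ℝ) :
    slowness V E σ s ≤ 1 := by
  by_cases hs : s = 0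
  · rw [hs, slowness_zero]; exact zero_le_one
  · rw [slowness_of_ne hs]
    exact inv_le_one_of_one_le₀ (one_le_speed hσ hE hs)

/-- The speed becomes infinite at the centre, so `0` is the continuous value of its inverse there.
Thus the travel time is `C¹` across the collision. -/
theorem continuous_slowness (hV : ContDiffOn ℝ ∞ V (Ioi 0)) (hV0 : Tendsto V (𝓝[>] 0) atTop)
    (hσ : 0 < σ) (hE : ∀ s, 0 < s → s ≤ σ → 1 ≤ 2 * (E + V s)) :
    Continuous (slowness V E σ) := by
  have hm : Continuous fun s : ℝ => min |s| σ := by fun_prop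
  refine continuous_iff_continuousAt.2 fun s => ?_
  by_cases hs : s = 0
  · subst hs
    refine continuousAt_update_same.2 (tendsto_inv_atTop_zero.comp
      (Real.tendsto_sqrt_atTop.comp (Tendsto.const_mul_atTop two_pos
        (tendsto_atTop_add_const_left _ _ (hV0.comp ?_)))))
    refine tendsto_nhdsWithin_iff.2 ⟨?_, ?_⟩
    · have := hm.tendsto 0
      simp only [abs_zero, min_eq_left hσ.le] at this
      exact this.mono_left nhdsWithin_le_nhds
    · filter_upwards [self_mem_nhdsWithin] with s hs using lt_min (abs_pos.2 hs) hσ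
  · refine (continuousAt_update_of_ne hs).2 ?_
    have h1 : ContinuousAt V (min |s| σ) :=
      (hasDerivAt_of_smooth hV (lt_min (abs_pos.2 hs) hσ)).continuousAt
    have h2 : ContinuousAt (fun s => V (min |s| σ)) s :=
      ContinuousAt.comp (f := fun s : ℝ => min |s| σ) h1 hm.continuousAt
    exact ((continuousAt_const.mul (continuousAt_const.add h2)).sqrt).inv₀
      (one_pos.trans_le (one_le_speed hσ hE hs)).ne'

/-- The signed travel time is an increasing odd bijection. -/
theorem exists_travelTime (hV : ContDiffOn ℝ ∞ V (Ioi 0)) (hV0 : Tendsto V (𝓝[>] 0) atTop)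
    (hσ : 0 < σ) (hE : ∀ s, 0 < s → s ≤ σ → 1 ≤ 2 * (E + V s)) :
    ∃ G : ℝ ≃o ℝ, (∀ s, HasDerivAt G (slowness V E σ s) s) ∧ (∀ s, G (-s) = -G s) ∧
      ∀ s, 0 ≤ s → G s ≤ s := by
  have hc := continuous_slowness hV hV0 hσ hE
  let G : ℝ → ℝ := fun u => ∫ s in (0 : ℝ)..u, slowness V E σ s
  have hG : ∀ s, HasDerivAt G (slowness V E σ s) s := fun s =>
    (hc.integral_hasStrictDerivAt 0 s).hasDerivAt
  have hGc : Continuous G := continuous_iff_continuousAt.2 fun s => (hG s).continuousAt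
  -- The derivative vanishes at `0`, so strict monotonicity is proved on each half-line separately.
  have hmono : StrictMono G := by
    refine StrictMonoOn.Iic_union_Ici (a := 0) ?_ ?_
    · refine strictMonoOn_of_deriv_pos (convex_Iic 0) hGc.continuousOn fun s hs => ?_
      rw [interior_Iic] at hs
      rw [(hG s).deriv]
      exact slowness_pos hσ hE (ne_of_lt hs)
    · refine strictMonoOn_of_deriv_pos (convex_Ici 0) hGc.continuousOn fun s hs => ?_
      rw [interior_Ici] at hs
      rw [(hG s).deriv]
      exact slowness_pos hσ hE (ne_of_gt hs)
  have hodd : ∀ s, G (-s) = -G s := fun s => by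
    have h1 := intervalIntegral.integral_comp_neg (a := 0) (b := s) (slowness V E σ)
    simp only [slowness_neg, neg_zero] at h1
    simp only [G]
    rw [h1, intervalIntegral.integral_symm]
  have hG0 : G 0 = 0 := intervalIntegral.integral_same
  -- Freezing beyond `σ` gives `G` a constant positive slope there, hence surjectivity.
  have htop : Tendsto G atTop atTop := by
    have hk : 0 < slowness V E σ σ := slowness_pos hσ hE hσ.ne'
    have hm : MonotoneOn (fun s => G s - slowness V E σ σ * s) (Ici σ) := by
      refine monotoneOn_of_deriv_nonneg (convex_Ici σ) (by fun_prop) (fun s _ => ?_) fun s hs => ?_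
      · exact ((hG s).sub ((hasDerivAt_id s).const_mul _)).differentiableAt.differentiableWithinAt
      · rw [interior_Ici] at hs
        have hs0 : s ≠ 0 := (hσ.trans hs).ne'
        have := ((hG s).sub ((hasDerivAt_id s).const_mul (slowness V E σ σ))).deriv
        simp only [id] at this
        refine le_of_le_of_eq ?_ this.symm
        rw [slowness_of_ne hs0, slowness_of_ne hσ.ne', abs_of_pos (hσ.trans hs), abs_of_pos hσ,
          min_eq_right (le_of_lt hs), min_self]
        simp
    refine tendsto_atTop_mono' atTop (f₁ := fun s => slowness V E σ σ * s +
      (G σ - slowness V E σ σ * σ)) ?_ ?_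
    · filter_upwards [eventually_ge_atTop σ] with s hs
      have := hm (le_refl σ) hs hs
      simp only at this
      linarith
    · exact tendsto_atTop_add_const_right _ _ (Tendsto.const_mul_atTop hk tendsto_id)
  have hbot : Tendsto G atBot atBot := by
    have : G = fun s => -G (-s) := funext fun s => by rw [hodd, neg_neg]
    rw [this]
    exact tendsto_neg_atTop_atBot.comp (htop.comp tendsto_neg_atBot_atTop)
  refine ⟨hmono.orderIsoOfSurjective G (hGc.surjective htop hbot), hG, hodd, fun s hs => ?_⟩
  have hm : MonotoneOn (fun s => s - G s) (Ici 0) := by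
    refine monotoneOn_of_deriv_nonneg (convex_Ici 0) (by fun_prop) (fun s _ => ?_) fun s hs => ?_
    · exact ((hasDerivAt_id s).sub (hG s)).differentiableAt.differentiableWithinAt
    · have := ((hasDerivAt_id s).sub (hG s)).deriv
      refine le_of_le_of_eq ?_ this.symm
      linarith [slowness_le_one hσ hE s]
  have := hm (le_refl (0 : ℝ)) hs hs
  simp only [hG0] at this
  change G s ≤ s
  linarith

end Slowness

/-- A radial trajectory that passes through the centre by transmission. -/
theorem exists_flowsTo_radial (hV : ContDiffOn ℝ ∞ V (Ioi 0)) (hV0 : Tendsto V (𝓝[>] 0) atTop)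
    {E σ : ℝ} (hE : ∀ s, 0 < s → s ≤ σ → 1 ≤ 2 * (E + V s)) {r₁ r₂ : ℝ} (hr₁ : 0 < r₁)
    (hr₁σ : r₁ < σ) (hr₂ : 0 < r₂) (hr₂σ : r₂ < σ) {e : Plane} (he : ‖e‖ = 1) :
    ∃ t ∈ Ioc 0 (r₁ + r₂), FlowsTo V t (-(r₁ • e), Real.sqrt (2 * (E + V r₁)) • e) 0
      (r₂ • e, Real.sqrt (2 * (E + V r₂)) • e) := by
  have hσ : 0 < σ := hr₁.trans hr₁σ
  obtain ⟨G, hG, hodd, hle⟩ := exists_travelTime hV hV0 hσ hE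
  have hG0 : G 0 = 0 := by have := hodd 0; rw [neg_zero] at this; linarith
  have he0 : e ≠ 0 := fun h => by simp [h] at he
  -- The signed position is the inverse of the travel time, shifted so that the centre is reached at
  -- time `G r₁`.
  let u : ℝ → ℝ := fun t => G.symm (t - G r₁)
  have huc : Continuous u := G.symm.continuous.comp (continuous_id.sub continuous_const)
  have hGu : ∀ t, G (u t) = t - G r₁ := fun t => G.apply_symm_apply _
  have hu_iff : ∀ s t, G s = t - G r₁ → u t = s := fun s t h => by
    simp only [u]; rw [← h, G.symm_apply_apply]
  have hd : ∀ t, u t ≠ 0 → HasDerivAt u (slowness V E σ (u t))⁻¹ t := fun t h0 => by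
    have h1 : HasDerivAt (fun s => G s + G r₁) (slowness V E σ (u t)) (u t) :=
      (hG (u t)).add_const _
    refine h1.of_local_left_inverse huc.continuousAt (slowness_pos hσ hE h0).ne' ?_
    exact Eventually.of_forall fun s => by simp only [hGu]; ring
  have hu0 : u 0 = -r₁ := hu_iff _ _ (by rw [hodd]; ring)
  have hu1 : u (G r₁ + G r₂) = r₂ := hu_iff _ _ (by ring)
  have humono : Monotone u := fun s t hst => G.symm.monotone (by linarith)
  have hT : 0 < G r₁ + G r₂ := by
    have h1 := G.strictMono hr₁
    have h2 := G.strictMono hr₂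
    linarith
  have habs : ∀ t ∈ Icc 0 (G r₁ + G r₂), |u t| < σ := fun t ht => by
    have h1 := humono ht.1
    have h2 := humono ht.2
    rw [hu0] at h1
    rw [hu1] at h2
    exact abs_lt.2 ⟨by linarith, by linarith⟩
  have hinv : ∀ t ∈ Icc 0 (G r₁ + G r₂), u t ≠ 0 →
      (slowness V E σ (u t))⁻¹ = Real.sqrt (2 * (E + V |u t|)) := fun t ht h0 => by
    rw [slowness_of_ne h0, inv_inv, min_eq_left (habs t ht).le]
  refine ⟨G r₁ + G r₂, ⟨hT, add_le_add (hle _ hr₁.le) (hle _ hr₂.le)⟩,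
    fun t => u t • e, fun t => Real.sqrt (2 * (E + V |u t|)) • e, ?_, ?_, Or.inr ⟨rfl, ?_⟩⟩
  · simp only [hu0, abs_neg, abs_of_pos hr₁, neg_smul]
  · simp only [hu1, abs_of_pos hr₂]
  refine ⟨?_, ?_, (huc.smul continuous_const).continuousOn, fun t ht hne => ?_, fun τ hτ h0 => ?_⟩
  · simp [hu0, hr₁.ne', he0]
  · simp [hu1, hr₂.ne', he0]
  · have h0 : u t ≠ 0 := fun h => hne (by simp [h])
    have h1 : HasDerivAt u (Real.sqrt (2 * (E + V |u t|))) t := hinv t ht h0 ▸ hd t h0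
    refine ⟨(h1.smul_const e).hasDerivWithinAt, ?_⟩
    have hpos : 0 < |u t| := abs_pos.2 h0
    have h2E := hE _ hpos (habs t ht).le
    have h2 : HasDerivAt (fun s => |u s|)
        (SignType.sign (u t) * Real.sqrt (2 * (E + V |u t|))) t := (hasDerivAt_abs h0).comp t h1
    have h3 := (((hasDerivAt_of_smooth hV hpos).comp t h2).const_add E).const_mul 2
    have h4 := (h3.sqrt (by simp only [Function.comp]; linarith)).smul_const e
    refine h4.hasDerivWithinAt.congr_deriv ?_
    rw [force_eq hV (Or.inr hne), rho_zero, norm_smul, he, mul_one, Real.norm_eq_abs, smul_smul]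
    congr 1
    have hs : Real.sqrt (2 * (E + V |u t|)) ≠ 0 := (Real.sqrt_pos.2 (by linarith)).ne'
    have hsg : (SignType.sign (u t) : ℝ) * |u t| = u t := sign_mul_abs _
    simp only [Function.comp]
    field_simp
    rw [mul_assoc, hsg]
  · have h0' : u τ = 0 := (smul_eq_zero.1 h0).resolve_right he0
    have hτ' : τ = G r₁ := by
      have := hGu τ
      rw [h0', hG0] at this
      linarith
    filter_upwards [self_mem_nhdsWithin] with s hs
    have hs0 : (0 : ℝ) < s := hs
    -- Oddness of `G` is exactly the transmission symmetry about the collision time.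
    have hneg : u (τ - s) = -u (τ + s) := hu_iff _ _ (by rw [hodd, hGu, hτ']; ring)
    have hne : u (τ + s) ≠ 0 := fun h => by
      have := hGu (τ + s)
      rw [h, hG0, hτ'] at this
      linarith
    refine ⟨?_, ?_, ?_⟩
    · rw [hneg]; simp [hne, he0]
    · rw [hneg, neg_smul, neg_neg]
    · rw [hneg, abs_neg]

/-! ### Passing near the centre -/

theorem monotoneOn_Icc_of_hasDerivWithinAt_nonneg {f f' : ℝ → ℝ} {a b : ℝ}
    (h : ∀ t ∈ Icc a b, HasDerivWithinAt f (f' t) (Icc a b) t) (h0 : ∀ t ∈ Icc a b, 0 ≤ f' t) :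
    MonotoneOn f (Icc a b) :=
  monotoneOn_of_hasDerivWithinAt_nonneg (convex_Icc a b)
    (fun t ht => (h t ht).continuousWithinAt)
    (fun t ht => (h t (interior_subset ht)).mono interior_subset)
    fun t ht => h0 t (interior_subset ht)

theorem norm_vel_sq {ε : ℝ} (x v : Plane) :
    ‖v‖ ^ 2 = 2 * (energy V ε x v + V (rho ε x)) := by
  rw [energy]; ring

/-- States of given energy and nonzero angular momentum, or with a smoothed potential, stay away
from the singularity. -/
theorem ClassVStar.exists_lt_rho (hV : ClassVStar V) {ε E c : ℝ} (hε : 0 ≤ ε)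
    (h : 0 < ε ∨ c ≠ 0) :
    ∃ κ > 0, ∀ x v : Plane, energy V ε x v = E → ang x v = c → κ < rho ε x := by
  by_cases hε' : 0 < ε
  · refine ⟨ε / 2, by positivity, fun x v _ _ => ?_⟩
    have : ε ≤ rho ε x := Real.le_sqrt_of_sq_le (by nlinarith [sq_nonneg ‖x‖])
    linarith
  obtain rfl : ε = 0 := le_antisymm (not_lt.1 hε') hε
  have hc : 0 < c ^ 2 := sq_pos_of_ne_zero (h.resolve_left hε')
  -- Lagrange's identity gives `c² ≤ ‖x‖² ‖v‖² = 2 ‖x‖² (E + V ‖x‖)`, which is impossible once the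
  -- right side drops below `c²`.
  have h1 : Tendsto (fun x : ℝ => 2 * (x ^ 2 * E) + 2 * (x ^ 2 * V x)) (𝓝[>] 0) (𝓝 0) := by
    have h2 : Tendsto (fun x : ℝ => 2 * (x ^ 2 * E)) (𝓝[>] 0) (𝓝 0) := by
      have : Continuous fun x : ℝ => 2 * (x ^ 2 * E) := by fun_prop
      have := this.tendsto 0
      simp only [ne_eq, OfNat.ofNat_ne_zero, not_false_eq_true, zero_pow, zero_mul, mul_zero]
        at this
      exact this.mono_left nhdsWithin_le_nhds
    simpa using h2.add (hV.tendsto_sq_mul.const_mul 2)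
  obtain ⟨κ, hκ, hlt⟩ := exists_of_eventually_nhdsGT (h1.eventually_lt_const hc)
  refine ⟨κ, hκ, fun x v hE hA => ?_⟩
  by_contra hle
  rw [rho_zero, not_lt] at hle
  have hl := ang_sq_add_inner_sq x v
  rw [hA, norm_vel_sq (V := V) (ε := 0) x v, hE, rho_zero] at hl
  have hx : 0 < ‖x‖ := by
    rcases (norm_nonneg x).eq_or_lt with h0 | h0
    · rw [← h0] at hl
      nlinarith [sq_nonneg (inner ℝ x v : ℝ)]
    · exact h0
  nlinarith [hlt _ hx hle, sq_nonneg (inner ℝ x v : ℝ)]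

/-- The set of parameters and states with bounded parameter, position and velocity whose smoothed
distance from the centre is at least `κ`. -/
def phaseBox (s r κ W : ℝ) : Set (ℝ × Phase) :=
  {p | |p.1| ≤ s ∧ ‖p.2.1‖ ≤ r ∧ κ ≤ rho p.1 p.2.1 ∧ ‖p.2.2‖ ^ 2 ≤ W}

theorem continuous_rho_fst : Continuous fun p : ℝ × Phase => rho p.1 p.2.1 := by
  unfold rho; fun_prop

theorem isCompact_phaseBox (s r κ W : ℝ) : IsCompact (phaseBox s r κ W) := by
  have hKc : IsClosed (phaseBox s r κ W) := by
    refine IsClosed.and (isClosed_le (by fun_prop) continuous_const)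
      (IsClosed.and (isClosed_le (by fun_prop) continuous_const)
      (IsClosed.and (isClosed_le continuous_const continuous_rho_fst)
        (isClosed_le (by fun_prop) continuous_const)))
  refine Metric.isCompact_of_isClosed_isBounded hKc
    ((Metric.isBounded_closedBall (x := 0) (r := max s (max r (W + 1)))).subset ?_)
  rintro ⟨s', x, v⟩ ⟨h1, h2, -, h4⟩
  simp only at h1 h2 h4
  rw [mem_closedBall_zero_iff, Prod.norm_def, Prod.norm_def]
  exact max_le_max h1 (max_le_max h2 (by simp only; nlinarith [sq_nonneg (‖v‖ - 1)]))

theorem phaseBox_subset (s r W : ℝ) {κ : ℝ} (hκ : 0 < κ) : phaseBox s r κ W ⊆ regularSet := by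
  rintro ⟨s', x, v⟩ ⟨-, -, h3, -⟩
  by_contra hn
  simp only [regularSet, mem_ofPred_eq, not_or, not_not] at hn
  simp only [hn.1, hn.2, rho_zero, norm_zero] at h3
  linarith

theorem mem_interior_phaseBox {s r κ W : ℝ} {p : ℝ × Phase} (h1 : |p.1| < s) (h2 : ‖p.2.1‖ < r)
    (h3 : κ < rho p.1 p.2.1) (h4 : ‖p.2.2‖ ^ 2 < W) : p ∈ interior (phaseBox s r κ W) := by
  rw [mem_interior_iff_mem_nhds]
  have e1 : ∀ᶠ p' : ℝ × Phase in 𝓝 p, |p'.1| < s :=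
    (Continuous.tendsto (by fun_prop) p).eventually_lt_const h1
  have e2 : ∀ᶠ p' : ℝ × Phase in 𝓝 p, ‖p'.2.1‖ < r :=
    (Continuous.tendsto (by fun_prop) p).eventually_lt_const h2
  have e3 : ∀ᶠ p' : ℝ × Phase in 𝓝 p, κ < rho p'.1 p'.2.1 :=
    (continuous_rho_fst.tendsto p).eventually_const_lt h3
  have e4 : ∀ᶠ p' : ℝ × Phase in 𝓝 p, ‖p'.2.2‖ ^ 2 < W :=
    (Continuous.tendsto (by fun_prop) p).eventually_lt_const h4
  filter_upwards [e1, e2, e3, e4] with p' a1 a2 a3 a4 using ⟨a1.le, a2.le, a3.le, a4.le⟩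

/-- A solution inside a small disc can be continued until it reaches the boundary of the disc. -/
theorem ClassVStar.exists_solution_until_exit (hV : ClassVStar V) {ε η M σ r T : ℝ} (hε : 0 ≤ ε)
    (hsc : IsScale V η M σ) (hr : ∀ x : Plane, ‖x‖ ≤ r → rho ε x ≤ σ) {q p : Plane}
    (hq : ‖q‖ ≤ r) (h : 0 < ε ∨ ang q p ≠ 0) (hT : 0 ≤ T) :
    ∃ t₁ ∈ Icc 0 T, ∃ x v : ℝ → Plane, x 0 = q ∧ v 0 = p ∧ IsSolutionOn V ε (Icc 0 t₁) x v ∧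
      (∀ t ∈ Icc 0 t₁, ‖x t‖ ≤ r) ∧ (t₁ = T ∨ ‖x t₁‖ = r) := by
  obtain ⟨κ, hκ, hlow⟩ := hV.exists_lt_rho (E := energy V ε q p) hε h
  have hκσ : κ ≤ σ := (hlow q p rfl rfl).le.trans (hr q hq)
  have hanti := hsc.antitoneOn hV.smooth
  obtain ⟨W, hW⟩ : ∃ W, W = 2 * (energy V ε q p + V κ) + 1 := ⟨_, rfl⟩
  have hvel : ∀ x v : Plane, energy V ε x v = energy V ε q p → ang x v = ang q p → ‖x‖ ≤ r →
      ‖v‖ ^ 2 < W := fun x v hE hA hx => by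
    have h1 := hlow x v hE hA
    have h2 : V (rho ε x) ≤ V κ := hanti ⟨hκ, hκσ⟩ ⟨hκ.trans h1, hr x hx⟩ h1.le
    rw [norm_vel_sq (V := V) (ε := ε), hE, hW]
    linarith
  have hmem : (ε, q, p) ∈ phaseBox (ε + 1) r κ W := ⟨by rw [abs_of_nonneg hε]; linarith, hq, (hlow q p rfl rfl).le,
    (hvel q p rfl rfl hq).le⟩
  obtain ⟨t₁, ht₁, γ, h0, hγ, hγK, hex⟩ := exists_isCurve_until_exit isOpen_regularSet
    (contDiffOn_field hV.smooth) (isCompact_phaseBox _ _ _ _) (phaseBox_subset _ _ _ hκ) hmem hT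
  obtain ⟨hc, hs⟩ := hγ.isSolutionOn hV.smooth hε (hγK.mono_right (phaseBox_subset _ _ _ hκ)) (by rw [h0])
  refine ⟨t₁, ht₁, fun t => (γ t).2.1, fun t => (γ t).2.2, by simp only [h0], by simp only [h0], hs, fun t ht => (hγK ht).2.1, ?_⟩
  refine hex.imp_right fun hex => ?_
  -- Conservation of energy and angular momentum makes every other constraint of the box strict, so
  -- the only face available for exit is `‖x‖ = r`. The added units in `ε + 1` and `W` provide this
  -- strictness.
  by_contra hne
  have hI : t₁ ∈ Icc 0 t₁ := ⟨ht₁.1, le_rfl⟩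
  have hx := (hγK hI).2.1
  have hE := hs.energy_eq hV.smooth hI
  have hA := hs.ang_eq hV.smooth hI
  simp only [h0] at hE hA
  refine hex (mem_interior_phaseBox ?_ (hx.lt_of_ne hne) ?_ (hvel _ _ hE hA hx))
  · rw [hc t₁ hI, abs_of_nonneg hε]; linarith
  · rw [hc t₁ hI]; exact hlow _ _ hE hA

/-- A regular trajectory that enters a small disc towards the centre leaves it again, after a
short time and with almost the same direction of the velocity. -/
theorem ClassVStar.exists_pass_of_regular (hV : ClassVStar V) {ε η M σ r : ℝ} (hε : 0 ≤ ε)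
    (hη : 0 < η) (hη' : η ≤ 1 / 2) (hη4 : 2 * Real.pi * η ≤ 1 / 4) (hM : 1 ≤ M)
    (hsc : IsScale V η M σ)
    (hr : ∀ x : Plane, ‖x‖ ≤ r → rho ε x ≤ σ) {q p : Plane} (hq : ‖q‖ < r)
    (h : 0 < ε ∨ ang q p ≠ 0) (hE : -2 * energy V ε q p ≤ M) {e : Plane} (he : ‖e‖ = 1)
    (hpe : ‖dir p - e‖ ≤ 1 / 4) :
    ∃ t₁ ∈ Ioc 0 (4 * r), ∃ x v : ℝ → Plane, x 0 = q ∧ v 0 = p ∧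
      IsSolutionOn V ε (Icc 0 t₁) x v ∧ ‖x t₁‖ = r ∧ 0 ≤ inner ℝ (x t₁) (v t₁) ∧
      v t₁ ≠ 0 ∧ ‖dir (v t₁) - dir p‖ ≤ 2 * Real.pi * η := by
  have hr0 : 0 < r := (norm_nonneg q).trans_lt hq
  -- The horizon `4 * r + 1` exceeds the time bound proved below, which rules out the alternative of
  -- never reaching the boundary.
  obtain ⟨t₁, ht₁, x, v, rfl, rfl, hs, hx, hex⟩ :=
    hV.exists_solution_until_exit (T := 4 * r + 1) hε hsc hr hq.le h (by linarith)
  have hρ : ∀ t ∈ Icc 0 t₁, 0 < rho ε (x t) := fun t ht => rho_pos (hs.regular ht)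
  have hσ : ∀ t ∈ Icc 0 t₁, rho ε (x t) ≤ σ := fun t ht => hr _ (hx t ht)
  have hVM : ∀ t ∈ Icc 0 t₁, M ≤ V (rho ε (x t)) := fun t ht =>
    (hsc.2 _ (hρ t ht) (hσ t ht)).1
  have hvV : ∀ t ∈ Icc 0 t₁, V (rho ε (x t)) ≤ ‖v t‖ ^ 2 := fun t ht => by
    rw [norm_vel_sq (V := V) (ε := ε) (x t), hs.energy_eq hV.smooth ht]
    linarith [hVM t ht]
  have hdir : ∀ t ∈ Icc 0 t₁, ‖dir (v t) - dir (v 0)‖ ≤ 2 * Real.pi * η := fun t ht =>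
    hs.norm_dir_sub_le hV.smooth hη hη' (one_pos.trans_le hM) hsc hσ hvV ht
  have hv1 : ∀ t ∈ Icc 0 t₁, 1 ≤ ‖v t‖ := fun t ht => by
    have := (hM.trans (hVM t ht)).trans (hvV t ht)
    nlinarith [norm_nonneg (v t)]
  have hv0 : ∀ t ∈ Icc 0 t₁, v t ≠ 0 := fun t ht h0 => by
    have := hv1 t ht
    rw [h0, norm_zero] at this
    linarith
  have hve : ∀ t ∈ Icc 0 t₁, 1 / 2 ≤ inner ℝ (v t) e := fun t ht => by
    have h1 : ‖dir (v t) - e‖ ≤ 1 / 2 := by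
      have := norm_sub_le_norm_sub_add_norm_sub (dir (v t)) (dir (v 0)) e
      linarith [hdir t ht]
    have h2 := norm_sub_sq_real (dir (v t)) e
    rw [norm_dir (hv0 t ht), he] at h2
    have h3 : 1 / 2 ≤ inner ℝ (dir (v t)) e := by nlinarith [norm_nonneg (dir (v t) - e)]
    rw [← norm_smul_dir (hv0 t ht), real_inner_smul_left]
    nlinarith [hv1 t ht]
  have hI0 : (0 : ℝ) ∈ Icc 0 t₁ := ⟨le_rfl, ht₁.1⟩
  have hI1 : t₁ ∈ Icc 0 t₁ := ⟨ht₁.1, le_rfl⟩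
  -- The coordinate along `e` grows at rate at least `1 / 2` and varies by at most the diameter `2 *
  -- r`.
  have htime : t₁ ≤ 4 * r := by
    have hm : MonotoneOn (fun t => inner ℝ (x t) e - 1 / 2 * t) (Icc 0 t₁) := by
      refine monotoneOn_Icc_of_hasDerivWithinAt_nonneg
        (f' := fun t => inner ℝ (v t) e - 1 / 2) (fun t ht => ?_)
        fun t ht => by linarith [hve t ht]
      have h1 := (hs t ht).2.1.inner ℝ (hasDerivWithinAt_const t (Icc 0 t₁) e)
      have h2 := (hasDerivWithinAt_id t (Icc 0 t₁)).const_mul (1 / 2 : ℝ)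
      exact (h1.sub h2).congr_deriv (by simp)
    have h1 := hm hI0 hI1 ht₁.1
    simp only [mul_zero, sub_zero] at h1
    have h2 := abs_le.1 ((abs_real_inner_le_norm (x 0) e))
    have h3 := abs_le.1 ((abs_real_inner_le_norm (x t₁) e))
    rw [he] at h2 h3
    linarith [h2.1, h3.2, hx t₁ hI1]
  have hxr : ‖x t₁‖ = r := hex.resolve_left (by linarith)
  have htpos : 0 < t₁ := ht₁.1.lt_of_ne fun h0 => by
    rw [← h0] at hxr
    exact hq.ne hxr
  refine ⟨t₁, ⟨htpos, htime⟩, x, v, rfl, rfl, hs, hxr, ?_, hv0 t₁ hI1, hdir t₁ hI1⟩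
  -- The derivative is at least `‖v‖² - η V ≥ 0`. Were `⟨x, v⟩` negative at the exit, it would be
  -- negative throughout, and the distance to the centre could not have grown to `r`.
  have hmono : MonotoneOn (fun t => inner ℝ (x t) (v t)) (Icc 0 t₁) := by
    refine monotoneOn_Icc_of_hasDerivWithinAt_nonneg
      (fun t ht => hs.hasDeriv_inner hV.smooth ht) fun t ht => ?_
    have h1 := (hsc.2 _ (hρ t ht) (hσ t ht)).2
    have h2 : ‖x t‖ ^ 2 ≤ rho ε (x t) ^ 2 := by rw [rho_sq]; nlinarith [sq_nonneg ε]
    have h3 : deriv V (rho ε (x t)) / rho ε (x t) < 0 := div_neg_of_neg_of_pos h1.1 (hρ t ht)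
    have h4 : deriv V (rho ε (x t)) / rho ε (x t) * rho ε (x t) ^ 2 =
        rho ε (x t) * deriv V (rho ε (x t)) := by
      have := (hρ t ht).ne'
      field_simp
    have hV0 : 0 ≤ V (rho ε (x t)) := by linarith [hVM t ht]
    nlinarith [hvV t ht]
  by_contra hneg
  have hanti : MonotoneOn (fun t => -‖x t‖ ^ 2) (Icc 0 t₁) := by
    refine monotoneOn_Icc_of_hasDerivWithinAt_nonneg
      (fun t ht => ((hs t ht).2.1.norm_sq).neg) fun t ht => ?_
    have := hmono ht hI1 ht.2
    simp only at this
    linarith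
  have := hanti hI0 hI1 ht₁.1
  simp only [hxr] at this
  nlinarith [norm_nonneg (x 0)]

theorem continuousAt_potential_sqrt (hV : ContDiffOn ℝ ∞ V (Ioi 0)) {X : Type*}
    [TopologicalSpace X] {f : X → ℝ} {a : X} (hf : ContinuousAt f a) (h0 : 0 < f a) :
    ContinuousAt (fun b => V (Real.sqrt (f b))) a :=
  ContinuousAt.comp (f := fun b => Real.sqrt (f b))
    (hasDerivAt_of_smooth hV (Real.sqrt_pos.2 h0)).continuousAt hf.sqrt

set_option maxHeartbeats 400000 in
/-- Trajectories of energy near `h` that enter a small disc radially, up to a small perturbation,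
leave it after a short time, almost radially and in almost the same direction. -/
theorem ClassVStar.exists_pass (hV : ClassVStar V) (h : ℝ) {α : ℝ} (hα : 0 < α) :
    ∃ R > 0, ∀ (r₁ r₂ w₁ w₂ : ℝ) (e : Plane), 0 < r₁ → r₁ < r₂ → r₂ ≤ R → ‖e‖ = 1 → 0 < w₁ →
      0 < w₂ → w₁ ^ 2 = 2 * (h + V r₁) → w₂ ^ 2 = 2 * (h + V r₂) → ∀ δ > 0,
      ∀ᶠ p : Phase × ℝ in 𝓝[{p | 0 ≤ p.2}] ((-(r₁ • e), w₁ • e), 0),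
        ∃ t ∈ Ioc 0 α, ∃ (e' : Plane) (z : Phase), ‖e'‖ = 1 ∧ ‖e' - e‖ ≤ α ∧
          dist z (r₂ • e', w₂ • e') < δ ∧ FlowsTo V t p.1 p.2 z := by
  -- Three deviations, each at most `β`, add up between `e'` and `e`: exit position against exit
  -- velocity, turning inside the disc, and entry velocity against `e`. The choice of `η` makes the
  -- turning bound `2πη` equal to `β`.
  obtain ⟨β, hβ⟩ : ∃ β, β = min (1 / 4) (α / 3) := ⟨_, rfl⟩
  have hβ0 : 0 < β := hβ ▸ lt_min (by norm_num) (by positivity)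
  have hβ4 : β ≤ 1 / 4 := hβ ▸ min_le_left _ _
  have hβα : β ≤ α / 3 := hβ ▸ min_le_right _ _
  obtain ⟨η, hη⟩ : ∃ η, η = β / (2 * Real.pi) := ⟨_, rfl⟩
  have hη0 : 0 < η := by rw [hη]; positivity
  have hηβ : 2 * Real.pi * η = β := by rw [hη]; field_simp
  have hη2 : η ≤ 1 / 2 := by
    linarith [mul_le_mul_of_nonneg_right Real.pi_gt_three.le hη0.le]
  -- The level `2 * |h| + 3` ensures, for every energy above `h - 1`, both `‖v‖² ≥ V` and speed at
  -- least `1` inside the disc.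
  obtain ⟨σ, hsc⟩ := hV.exists_isScale hη0 (2 * |h| + 3)
  have hσ := hsc.1
  -- Half of `σ` leaves room for `ε` in the smoothed distance; `α / 4` turns the time bound `4 * r₂`
  -- into `α`.
  refine ⟨min (σ / 2) (α / 4), by positivity,
    fun r₁ r₂ w₁ w₂ e hr₁ hr₁₂ hr₂ he hw₁ hw₂ hh₁ hh₂ δ hδ => ?_⟩
  have hr₂0 : 0 < r₂ := hr₁.trans hr₁₂
  have hr₂σ : r₂ ≤ σ / 2 := hr₂.trans (min_le_left _ _)
  have hr₂α : r₂ ≤ α / 4 := hr₂.trans (min_le_right _ _)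
  obtain ⟨p₀, hp₀⟩ : ∃ p₀ : Phase × ℝ, p₀ = ((-(r₁ • e), w₁ • e), 0) := ⟨_, rfl⟩
  have hnq : ‖p₀.1.1‖ = r₁ := by simp [hp₀, norm_smul, he, abs_of_pos hr₁]
  have hnp : ‖p₀.1.2‖ = w₁ := by simp [hp₀, norm_smul, he, abs_of_pos hw₁]
  have hdir0 : dir p₀.1.2 = e := by
    rw [dir, hnp, hp₀, smul_smul, inv_mul_cancel₀ hw₁.ne', one_smul]
  have hang0 : ang p₀.1.1 p₀.1.2 = 0 := by simp [hp₀, ang]; ring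
  have hrad : ContinuousAt (fun p : Phase × ℝ => ‖p.1.1‖ ^ 2 + p.2 ^ 2) p₀ :=
    Continuous.continuousAt (by fun_prop)
  have hrad' : ContinuousAt (fun p : Phase × ℝ => r₂ ^ 2 + p.2 ^ 2) p₀ :=
    Continuous.continuousAt (by fun_prop)
  have hcE : ContinuousAt (fun p : Phase × ℝ => energy V p.2 p.1.1 p.1.2) p₀ :=
    ContinuousAt.sub (Continuous.continuousAt (by fun_prop))
      (continuousAt_potential_sqrt hV.smooth hrad (by rw [hnq]; positivity))
  have hE0 : energy V p₀.2 p₀.1.1 p₀.1.2 = h := by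
    have : p₀.2 = 0 := by rw [hp₀]
    rw [energy, this, rho_zero, hnq, hnp]; linarith
  have hcA : ContinuousAt (fun p : Phase × ℝ => ang p.1.1 p.1.2) p₀ :=
    (continuous_ang.comp continuous_fst).continuousAt
  -- By the conservation laws, `X` is the squared speed and `s` the radial velocity on the circle of
  -- radius `r₂`. Both are continuous in the initial data, so no continuity of the exit time or exit
  -- point is needed.
  let X : Phase × ℝ → ℝ := fun p =>
    2 * (energy V p.2 p.1.1 p.1.2 + V (Real.sqrt (r₂ ^ 2 + p.2 ^ 2)))
  have hcX : ContinuousAt X p₀ := continuousAt_const.mul (hcE.add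
    (continuousAt_potential_sqrt hV.smooth hrad' (by positivity)))
  have hX0 : X p₀ = w₂ ^ 2 := by
    have : p₀.2 = 0 := by rw [hp₀]
    simp only [X, hE0, hh₂]
    rw [this, zero_pow two_ne_zero, add_zero, Real.sqrt_sq hr₂0.le]
  let s : Phase × ℝ → ℝ := fun p => Real.sqrt (X p * r₂ ^ 2 - ang p.1.1 p.1.2 ^ 2) / r₂
  have hcs : ContinuousAt s p₀ :=
    (((hcX.mul continuousAt_const).sub (hcA.pow 2)).sqrt).div_const _
  have hs0 : s p₀ = w₂ := by
    simp only [s, hX0, hang0]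
    rw [zero_pow two_ne_zero, sub_zero, ← mul_pow, Real.sqrt_sq (by positivity)]
    field_simp
  -- This is the squared distance from the exit velocity to `w₂ • e'`, where `e'` is the unit exit
  -- position; `hcD'` treats the squared distance from `e'` to the direction of that velocity.
  have hcD : ContinuousAt (fun p => X p - 2 * (w₂ * s p) + w₂ ^ 2) p₀ :=
    (hcX.sub (continuousAt_const.mul (continuousAt_const.mul hcs))).add continuousAt_const
  have hcD' : ContinuousAt (fun p => 1 - 2 * (s p / Real.sqrt (X p)) + 1) p₀ :=
    (continuousAt_const.sub (continuousAt_const.mul (hcs.div hcX.sqrt (by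
      rw [hX0, Real.sqrt_sq hw₂.le]; exact hw₂.ne')))).add continuousAt_const
  have hcd : ContinuousAt (fun p : Phase × ℝ => ‖p.1.2‖⁻¹ • p.1.2 - e) p₀ := by
    have h1 : ContinuousAt (fun p : Phase × ℝ => ‖p.1.2‖) p₀ :=
      Continuous.continuousAt (by fun_prop)
    have h2 : ContinuousAt (fun p : Phase × ℝ => p.1.2) p₀ :=
      Continuous.continuousAt (by fun_prop)
    exact ((h1.inv₀ (by rw [hnp]; exact hw₁.ne')).smul h2).sub continuousAt_const
  have e1 : ∀ᶠ p : Phase × ℝ in 𝓝 p₀, ‖p.1.1‖ < r₂ :=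
    (Continuous.continuousAt (by fun_prop)).eventually_lt_const (by rw [hnq]; exact hr₁₂)
  have e1' : ∀ᶠ p : Phase × ℝ in 𝓝 p₀, 0 < ‖p.1.1‖ :=
    (Continuous.continuousAt (by fun_prop)).eventually_const_lt (by rw [hnq]; exact hr₁)
  have e2 : ∀ᶠ p : Phase × ℝ in 𝓝 p₀, r₂ ^ 2 + p.2 ^ 2 < σ ^ 2 :=
    hrad'.eventually_lt_const (by
      have : p₀.2 = 0 := by rw [hp₀]
      simp only [this]; nlinarith only [hr₂σ, hr₂0, hσ])
  have e3 : ∀ᶠ p : Phase × ℝ in 𝓝 p₀, h - 1 < energy V p.2 p.1.1 p.1.2 :=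
    hcE.eventually_const_lt (by simp only [hE0]; linarith)
  have e4 : ∀ᶠ p : Phase × ℝ in 𝓝 p₀, ‖dir p.1.2 - e‖ < β :=
    hcd.norm.eventually_lt_const (by
      change ‖dir p₀.1.2 - e‖ < β
      rw [hdir0, sub_self, norm_zero]; exact hβ0)
  have e5 : ∀ᶠ p in 𝓝 p₀, X p - 2 * (w₂ * s p) + w₂ ^ 2 < δ ^ 2 :=
    hcD.eventually_lt_const (by simp only [hX0, hs0]; nlinarith only [sq_pos_of_pos hδ])
  have e6 : ∀ᶠ p in 𝓝 p₀, 1 - 2 * (s p / Real.sqrt (X p)) + 1 < β ^ 2 :=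
    hcD'.eventually_lt_const (by
      simp only [hX0, hs0]
      rw [Real.sqrt_sq hw₂.le, div_self hw₂.ne']; nlinarith only [sq_pos_of_pos hβ0])
  have e7 : ∀ᶠ p : Phase × ℝ in 𝓝 p₀, (inner ℝ p.1.1 p.1.2 : ℝ) < 0 :=
    (Continuous.continuousAt (by fun_prop)).eventually_lt_const (by
      rw [hp₀]
      simp only [inner_neg_left, real_inner_smul_left, real_inner_smul_right,
        real_inner_self_eq_norm_sq, he]
      nlinarith only [mul_pos hr₁ hw₁])
  have e8 : ∀ᶠ p : Phase × ℝ in 𝓝 p₀, 0 < ‖p.1.2‖ :=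
    (Continuous.continuousAt (by fun_prop)).eventually_const_lt (by rw [hnp]; exact hw₁)
  rw [← hp₀]
  filter_upwards [self_mem_nhdsWithin, nhdsWithin_le_nhds (e1.and (e1'.and (e2.and (e3.and
    (e4.and (e5.and (e6.and (e7.and e8))))))))]
  rintro ⟨⟨q, p⟩, ε⟩ hε ⟨e1, e1', e2, e3, e4, e5, e6, e7, e8⟩
  simp only at e1 e1' e2 e3 e4 e7 e8
  replace hε : 0 ≤ ε := hε
  have hp0 : p ≠ 0 := norm_pos_iff.1 e8
  by_cases hreg : 0 < ε ∨ ang q p ≠ 0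
  · have hr : ∀ x : Plane, ‖x‖ ≤ r₂ → rho ε x ≤ σ := fun x hx => by
      refine Real.sqrt_le_iff.2 ⟨hσ.le, ?_⟩
      nlinarith only [norm_nonneg x, hx, e2]
    obtain ⟨t, ht, x, v, rfl, rfl, hs, hxr, hxv, hv0, hdir⟩ :=
      hV.exists_pass_of_regular hε hη0 hη2 (hηβ ▸ hβ4) (by linarith [abs_nonneg h]) hsc hr e1
        hreg (by linarith [neg_abs_le h]) he (e4.le.trans hβ4)
    have hI : t ∈ Icc 0 t := ⟨ht.1.le, le_rfl⟩
    have hv2 : ‖v t‖ ^ 2 = X ((x 0, v 0), ε) := by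
      rw [norm_vel_sq (V := V) (ε := ε) (x t), hs.energy_eq hV.smooth hI, rho, hxr]
    have hvs : ‖v t‖ = Real.sqrt (X ((x 0, v 0), ε)) := by
      rw [← hv2, Real.sqrt_sq (norm_nonneg _)]
    have hin : inner ℝ (x t) (v t) / r₂ = s ((x 0, v 0), ε) := by
      have hl := ang_sq_add_inner_sq (x t) (v t)
      rw [hs.ang_eq hV.smooth hI, hxr, hv2] at hl
      simp only [s]
      rw [← Real.sqrt_sq hxv]
      congr 2
      linarith
    have hne : ‖r₂⁻¹ • x t‖ = 1 := by
      rw [norm_smul, hxr, norm_inv, Real.norm_of_nonneg hr₂0.le, inv_mul_cancel₀ hr₂0.ne']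
    have hxe : r₂ • (r₂⁻¹ • x t) = x t := by
      rw [smul_smul, mul_inv_cancel₀ hr₂0.ne', one_smul]
    have hie : inner ℝ (r₂⁻¹ • x t) (v t) = s ((x 0, v 0), ε) := by
      rw [real_inner_smul_left, ← hin]; ring
    refine ⟨t, ⟨ht.1, by linarith [ht.2]⟩, r₂⁻¹ • x t, (x t, v t), hne, ?_, ?_,
      hs.flowsTo hε ht.1.le⟩
    · have h1 := norm_sub_sq_real (r₂⁻¹ • x t) (dir (v t))
      rw [hne, norm_dir hv0, one_pow, dir, real_inner_smul_right, hie, hvs, ← hvs] at h1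
      have h2 : ‖r₂⁻¹ • x t - dir (v t)‖ ^ 2 < β ^ 2 := by
        rw [dir, h1, hvs]
        refine lt_of_eq_of_lt ?_ e6
        ring
      have h3 := lt_of_pow_lt_pow_left₀ 2 hβ0.le h2
      have h4 := norm_sub_le_norm_sub_add_norm_sub (r₂⁻¹ • x t) (dir (v t)) e
      have h5 := norm_sub_le_norm_sub_add_norm_sub (dir (v t)) (dir (v 0)) e
      linarith
    · rw [hxe, Prod.dist_eq]
      refine max_lt (by simpa using hδ) (lt_of_pow_lt_pow_left₀ 2 hδ.le ?_)
      rw [dist_eq_norm, norm_sub_sq_real, hv2, real_inner_smul_right, real_inner_comm, hie,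
        norm_smul, hne, mul_one, Real.norm_of_nonneg hw₂.le]
      exact e5
  -- Zero angular momentum together with `⟨q, p⟩ < 0` means motion straight into the centre, so the
  -- explicit radial trajectory applies.
  · rw [not_or, not_not] at hreg
    obtain rfl : ε = 0 := le_antisymm (not_lt.1 hreg.1) hε
    have hpos : ∀ s, 0 < s → s ≤ σ → 1 ≤ 2 * (energy V 0 q p + V s) := fun s hs hs' => by
      linarith [(hsc.2 s hs hs').1, neg_abs_le h, abs_nonneg h]
    have hl := ang_sq_add_inner_sq q p
    rw [hreg.2] at hl
    have hqe : q = -(‖q‖ • dir p) := by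
      have h1 : inner ℝ (-q) p = ‖-q‖ * ‖p‖ := by
        rw [inner_neg_left, norm_neg]
        refine (sq_eq_sq₀ (neg_pos.2 e7).le (mul_pos e1' e8).le).1 ?_
        linear_combination hl
      rw [inner_eq_norm_mul_iff_real, norm_neg] at h1
      rw [dir, smul_smul, mul_comm, ← smul_smul, ← h1, smul_smul, inv_mul_cancel₀ e8.ne',
        one_smul, neg_neg]
    have hpe : p = Real.sqrt (2 * (energy V 0 q p + V ‖q‖)) • dir p := by
      have h1 := norm_vel_sq (V := V) (ε := 0) q p
      rw [rho_zero] at h1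
      rw [← h1, Real.sqrt_sq (norm_nonneg _), norm_smul_dir hp0]
    obtain ⟨t, ht, hf⟩ := exists_flowsTo_radial hV.smooth hV.singular hpos e1'
      (by linarith : ‖q‖ < σ) hr₂0 (by linarith : r₂ < σ) (norm_dir hp0)
    rw [← hqe, ← hpe] at hf
    refine ⟨t, ⟨ht.1, by linarith [ht.2]⟩, dir p, _, norm_dir hp0, by linarith, ?_, hf⟩
    rw [Prod.dist_eq]
    refine max_lt (by simpa using hδ) (lt_of_pow_lt_pow_left₀ 2 hδ.le ?_)
    rw [dist_eq_norm, ← sub_smul, norm_smul, norm_dir hp0, mul_one, Real.norm_eq_abs, sq_abs]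
    refine lt_of_eq_of_lt ?_ e5
    have hX : X ((q, p), 0) = 2 * (energy V 0 q p + V r₂) := by
      simp only [X]
      rw [zero_pow two_ne_zero, add_zero, Real.sqrt_sq hr₂0.le]
    have hX0 : 0 ≤ 2 * (energy V 0 q p + V r₂) :=
      zero_le_one.trans (hpos r₂ hr₂0 (by linarith))
    have hs : s ((q, p), 0) = Real.sqrt (2 * (energy V 0 q p + V r₂)) := by
      simp only [s, hX, hreg.2]
      rw [zero_pow two_ne_zero, sub_zero, Real.sqrt_mul hX0, Real.sqrt_sq hr₂0.le]
      field_simp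
    rw [hs, hX, sub_sq, Real.sq_sqrt hX0]
    ring

/-! ### Transmission trajectories near a collision -/

theorem IsTransmissionSolution.isSolutionOn {T : ℝ} {x v : ℝ → Plane}
    (h : IsTransmissionSolution V T x v) {a b : ℝ} (hab : Icc a b ⊆ Icc 0 T)
    (hne : ∀ t ∈ Icc a b, x t ≠ 0) : IsSolutionOn V 0 (Icc a b) x v := fun t ht =>
  ⟨Or.inr (hne t ht), (h.motion t (hab ht) (hne t ht)).1.mono hab,
    (h.motion t (hab ht) (hne t ht)).2.mono hab⟩

/-- Solutions of the singular problem are radial before a collision. -/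
theorem ClassVStar.exists_radial_of_collision (hV : ClassVStar V) {τ s₀ : ℝ} (hs₀ : 0 < s₀)
    {x v : ℝ → Plane} (hs : ∀ s ∈ Ioc 0 s₀, IsSolutionOn V 0 (Icc (τ - s₀) (τ - s)) x v)
    (hx : Tendsto x (𝓝[<] τ) (𝓝 0)) :
    ∃ s₁ ∈ Ioc 0 s₀, ∃ (e : Plane) (h : ℝ), ‖e‖ = 1 ∧ ∀ s ∈ Ioc 0 s₁,
      v (τ - s) ≠ 0 ∧ x (τ - s) = -(‖x (τ - s)‖ • e) ∧ v (τ - s) = ‖v (τ - s)‖ • e ∧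
      ‖v (τ - s)‖ ^ 2 = 2 * (h + V ‖x (τ - s)‖) := by
  have hxs : Tendsto (fun s => x (τ - s)) (𝓝[>] 0) (𝓝 0) := by
    refine hx.comp (tendsto_nhdsWithin_iff.2 ⟨?_, ?_⟩)
    · have : Tendsto (fun s => τ - s) (𝓝 0) (𝓝 (τ - 0)) := by
        exact (continuous_const.sub continuous_id).tendsto 0
      rw [sub_zero] at this
      exact this.mono_left nhdsWithin_le_nhds
    · filter_upwards [self_mem_nhdsWithin] with s hs
      exact sub_lt_self τ hs
  have hmem : ∀ s ∈ Ioc 0 s₀, τ - s ∈ Icc (τ - s₀) (τ - s) := fun s hs' =>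
    ⟨by linarith [hs'.2], le_rfl⟩
  have hne : ∀ s ∈ Ioc 0 s₀, x (τ - s) ≠ 0 := fun s hs' => by
    simpa using ((hs s hs') _ (hmem s hs')).1
  have hnorm : Tendsto (fun s => ‖x (τ - s)‖) (𝓝[>] 0) (𝓝[>] 0) := by
    refine tendsto_nhdsWithin_iff.2 ⟨by simpa using hxs.norm, ?_⟩
    filter_upwards [Ioc_mem_nhdsGT hs₀] with s hs' using norm_pos_iff.2 (hne s hs')
  obtain ⟨h, hh⟩ : ∃ h, h = energy V 0 (x (τ - s₀)) (v (τ - s₀)) := ⟨_, rfl⟩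
  have hE : ∀ s ∈ Ioc 0 s₀, energy V 0 (x (τ - s)) (v (τ - s)) = h := fun s hs' =>
    hh ▸ (hs s hs').energy_eq hV.smooth (hmem s hs')
  have hA : ∀ s ∈ Ioc 0 s₀, ang (x (τ - s)) (v (τ - s)) = ang (x (τ - s₀)) (v (τ - s₀)) :=
    fun s hs' => (hs s hs').ang_eq hV.smooth (hmem s hs')
  have hA0 : ang (x (τ - s₀)) (v (τ - s₀)) = 0 := by
    by_contra hc
    obtain ⟨κ, hκ, hlow⟩ := hV.exists_lt_rho (E := h) le_rfl (Or.inr hc)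
    have h1 : ∀ᶠ s in 𝓝[>] (0 : ℝ), ‖x (τ - s)‖ < κ :=
      (by simpa using hxs.norm : Tendsto (fun s => ‖x (τ - s)‖) (𝓝[>] 0) (𝓝 0)).eventually_lt_const
        hκ
    obtain ⟨s, h2, h3⟩ := (h1.and (Ioc_mem_nhdsGT hs₀)).exists
    have := hlow _ _ (hE s h3) (hA s h3)
    rw [rho_zero] at this
    exact absurd this (not_lt.2 h2.le)
  have hvel : ∀ s ∈ Ioc 0 s₀, ‖v (τ - s)‖ ^ 2 = 2 * (h + V ‖x (τ - s)‖) := fun s hs' => by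
    rw [norm_vel_sq (V := V) (ε := 0) (x (τ - s)), hE s hs', rho_zero]
  obtain ⟨s', hs'0, hbig⟩ := exists_of_eventually_nhdsGT
    ((hV.singular.comp hnorm).eventually_gt_atTop (-h))
  obtain ⟨s₁, hs₁⟩ : ∃ s₁, s₁ = min s' s₀ := ⟨_, rfl⟩
  have hs₁0 : 0 < s₁ := hs₁ ▸ lt_min hs'0 hs₀
  have hs₁' : s₁ ≤ s₀ := hs₁ ▸ min_le_right _ _
  have hsub : ∀ s ∈ Ioc 0 s₁, s ∈ Ioc 0 s₀ := fun s hs' => ⟨hs'.1, hs'.2.trans hs₁'⟩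
  have hv0 : ∀ s ∈ Ioc 0 s₁, v (τ - s) ≠ 0 := fun s h1 h0 => by
    have h2 := hvel s (hsub s h1)
    have h3 := hbig s h1.1 (h1.2.trans (hs₁ ▸ min_le_left _ _))
    rw [h0, norm_zero] at h2
    simp only [Function.comp] at h3
    linarith
  have hsol : ∀ s ∈ Ioc 0 s₁, IsSolutionOn V 0 (Icc (τ - s₁) (τ - s)) x v := fun s h1 =>
    (hs s (hsub s h1)).mono (Icc_subset_Icc_left (by linarith))
  have hbetween : ∀ {s t : ℝ}, s ∈ Ioc 0 s₁ → t ∈ Icc (τ - s₁) (τ - s) → τ - t ∈ Ioc 0 s₁ :=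
    fun h1 h2 => ⟨by linarith [h1.1, h2.2], by linarith [h2.1]⟩
  obtain ⟨e, he⟩ : ∃ e, e = dir (v (τ - s₁)) := ⟨_, rfl⟩
  have he1 : ‖e‖ = 1 := he ▸ norm_dir (hv0 s₁ ⟨hs₁0, le_rfl⟩)
  have hve : ∀ s ∈ Ioc 0 s₁, v (τ - s) = ‖v (τ - s)‖ • e := fun s h1 => by
    have : dir (v (τ - s)) = e := by
      rw [he]
      refine eq_left_of_hasDerivWithinAt_zero (f := fun t => dir (v t)) (fun t ht => ?_) (τ - s)
        ⟨by linarith [h1.2], le_rfl⟩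
      have h2 := hbetween h1 ht
      have h3 := hv0 _ h2
      rw [sub_sub_cancel] at h3
      refine (hasDerivWithinAt_dir ((hsol s h1).hasDeriv_vel hV.smooth ht) h3).congr_deriv ?_
      have h4 := norm_sq_deriv_dir (v t) (x t) (deriv V (rho 0 (x t)) / rho 0 (x t))
      have h5 := hA _ (hsub _ h2)
      rw [sub_sub_cancel, hA0] at h5
      rw [h5, mul_zero, zero_pow two_ne_zero, sq_eq_zero_iff, norm_eq_zero] at h4
      rw [h4, smul_zero]
    rw [← this, norm_smul_dir (hv0 s h1)]
  refine ⟨s₁, ⟨hs₁0, hs₁'⟩, e, h, he1, fun s h1 => ⟨hv0 s h1, ?_, hve s h1, hvel s (hsub s h1)⟩⟩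
  -- The component of `x` along `e` increases to its limit `0`, hence is nonpositive; this fixes the
  -- sign in `x = -(‖x‖ • e)`.
  have hmono : ∀ s' ∈ Ioc 0 s, inner ℝ (x (τ - s)) e ≤ inner ℝ (x (τ - s')) e := fun s' h2 => by
    have h3 : s' ∈ Ioc 0 s₁ := ⟨h2.1, h2.2.trans h1.2⟩
    refine monotoneOn_Icc_of_hasDerivWithinAt_nonneg (f := fun t => inner ℝ (x t) e)
      (f' := fun t => inner ℝ (v t) e) (a := τ - s₁) (b := τ - s') (fun t ht => ?_)
      (fun t ht => ?_) ⟨by linarith [h1.2], by linarith [h2.2]⟩ ⟨by linarith [h3.2], le_rfl⟩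
      (by linarith [h2.2])
    · exact ((hsol s' h3 t ht).2.1.inner ℝ (hasDerivWithinAt_const t _ e)).congr_deriv (by simp)
    · have h4 := hve _ (hbetween h3 ht)
      rw [sub_sub_cancel] at h4
      rw [h4, real_inner_smul_left, real_inner_self_eq_norm_sq]
      positivity
  have hle : inner ℝ (x (τ - s)) e ≤ 0 := by
    have hlim : Tendsto (fun s' => inner ℝ (x (τ - s')) e) (𝓝[>] 0) (𝓝 (inner ℝ (0 : Plane) e)) :=
      hxs.inner tendsto_const_nhds
    rw [inner_zero_left] at hlim
    refine ge_of_tendsto hlim ?_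
    filter_upwards [Ioc_mem_nhdsGT h1.1] with s' h2 using hmono s' h2
  have hl := ang_sq_add_inner_sq (x (τ - s)) (v (τ - s))
  have hvn : 0 < ‖v (τ - s)‖ := norm_pos_iff.2 (hv0 s h1)
  have hin : inner ℝ (x (τ - s)) (v (τ - s)) = ‖v (τ - s)‖ * inner ℝ (x (τ - s)) e := by
    conv_lhs => rw [hve s h1]
    rw [real_inner_smul_right]
  rw [hA s (hsub s h1), hA0, hin] at hl
  have hsq : (-inner ℝ (x (τ - s)) e) ^ 2 = ‖x (τ - s)‖ ^ 2 := by
    refine mul_right_cancel₀ (pow_pos hvn 2).ne' ?_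
    linear_combination hl
  have hx1 : inner ℝ (-x (τ - s)) e = ‖-x (τ - s)‖ * ‖e‖ := by
    rw [inner_neg_left, norm_neg, he1, mul_one]
    exact (sq_eq_sq₀ (by linarith) (norm_nonneg _)).1 hsq
  rw [inner_eq_norm_mul_iff_real, he1, one_smul, norm_neg] at hx1
  rw [← hx1, neg_neg]

/-- A reflection suffices: the equations are equivariant under every linear isometry, and near the
collision the reference states are multiples of `e`, so only the image of `e` matters. -/
theorem exists_isometry_map_eq {e e' : Plane} (he : ‖e‖ = 1) (he' : ‖e'‖ = 1) :
    ∃ L : Plane ≃ₗᵢ[ℝ] Plane, L e = e' :=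
  ⟨_, Submodule.reflection_sub (he.trans he'.symm)⟩

theorem dist_map_phase (L : Plane ≃ₗᵢ[ℝ] Plane) (y z : Phase) :
    dist (L y.1, L y.2) (L z.1, L z.2) = dist y z := by
  rw [Prod.dist_eq, Prod.dist_eq, L.dist_map, L.dist_map]

/-- Near a collision a transmission trajectory is radial and avoids the centre at other times. -/
theorem IsTransmissionSolution.exists_radial (hV : ClassVStar V) {T τ : ℝ} {x v : ℝ → Plane}
    (h : IsTransmissionSolution V T x v) (hτ : τ ∈ Icc 0 T) (h0 : x τ = 0) :
    ∃ s₀ > 0, 0 ≤ τ - s₀ ∧ τ + s₀ ≤ T ∧ ∃ (e : Plane) (E : ℝ), ‖e‖ = 1 ∧ ∀ s ∈ Ioc 0 s₀,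
      x (τ - s) ≠ 0 ∧ v (τ - s) ≠ 0 ∧ x (τ - s) = -(‖x (τ - s)‖ • e) ∧
      v (τ - s) = ‖v (τ - s)‖ • e ∧ ‖v (τ - s)‖ ^ 2 = 2 * (E + V ‖x (τ - s)‖) ∧
      x (τ + s) = -x (τ - s) ∧ v (τ + s) = v (τ - s) := by
  have hτ0 : 0 < τ := hτ.1.lt_of_ne fun h' => h.start_ne (h' ▸ h0)
  have hτT : τ < T := hτ.2.lt_of_ne fun h' => h.end_ne (h' ▸ h0)
  obtain ⟨u, hu, hsym⟩ := exists_of_eventually_nhdsGT (h.transmission τ hτ h0)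
  obtain ⟨s₀, hs₀⟩ : ∃ s₀, s₀ = min u (min τ (T - τ)) := ⟨_, rfl⟩
  have hs₀0 : 0 < s₀ := hs₀ ▸ lt_min hu (lt_min hτ0 (sub_pos.2 hτT))
  have hs₀u : s₀ ≤ u := hs₀ ▸ min_le_left _ _
  have hs₀τ : s₀ ≤ τ := hs₀ ▸ (min_le_right _ _).trans (min_le_left _ _)
  have hs₀T : s₀ ≤ T - τ := hs₀ ▸ (min_le_right _ _).trans (min_le_right _ _)
  have hsol : ∀ s ∈ Ioc 0 s₀, IsSolutionOn V 0 (Icc (τ - s₀) (τ - s)) x v := fun s hs => by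
    refine h.isSolutionOn (Icc_subset_Icc (by linarith) (by linarith [hs.1, hτ.2])) fun t ht => ?_
    have := (hsym (τ - t) (by linarith [ht.2, hs.1]) (by linarith [ht.1])).1
    rwa [sub_sub_cancel] at this
  have hx : Tendsto x (𝓝[<] τ) (𝓝 0) := by
    have h1 := (h.continuousOn τ hτ).mono (Icc_subset_Icc_right hτT.le)
    rw [ContinuousWithinAt, h0, nhdsWithin_Icc_eq_nhdsLE hτ0] at h1
    exact h1.mono_left (nhdsWithin_mono _ Iio_subset_Iic_self)
  obtain ⟨s₁, hs₁, e, E, he, hrad⟩ := hV.exists_radial_of_collision hs₀0 hsol hx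
  refine ⟨s₁, hs₁.1, by linarith [hs₁.2], by linarith [hs₁.2], e, E, he, fun s hs => ?_⟩
  obtain ⟨a1, a2, a3⟩ := hsym s hs.1 (hs.2.trans (hs₁.2.trans hs₀u))
  obtain ⟨b1, b2, b3, b4⟩ := hrad s hs
  exact ⟨a1, b1, b2, b3, b4, a2, a3⟩

/-- Continuity of the flow map across a collision. -/
theorem IsTransmissionSolution.flowTendsto_collision (hV : ClassVStar V) {T τ : ℝ}
    {x v : ℝ → Plane} (h : IsTransmissionSolution V T x v) {s₀ : ℝ} (hτ0 : 0 ≤ τ - s₀)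
    (hτT : τ + s₀ ≤ T) {e : Plane} {E : ℝ} (he : ‖e‖ = 1) (h0 : x τ = 0)
    (hrad : ∀ s ∈ Ioc 0 s₀,
      x (τ - s) ≠ 0 ∧ v (τ - s) ≠ 0 ∧ x (τ - s) = -(‖x (τ - s)‖ • e) ∧
      v (τ - s) = ‖v (τ - s)‖ • e ∧ ‖v (τ - s)‖ ^ 2 = 2 * (E + V ‖x (τ - s)‖) ∧
      x (τ + s) = -x (τ - s) ∧ v (τ + s) = v (τ - s)) {s : ℝ} (hs : s ∈ Ioo 0 s₀) :
    FlowTendsto V (2 * s) (x (τ - s), v (τ - s)) (x (τ + s), v (τ + s)) := by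
  have hs₀ : 0 < s₀ := hs.1.trans hs.2
  have hτI : τ ∈ Icc 0 T := ⟨by linarith, by linarith⟩
  obtain ⟨r, hr⟩ : ∃ r : ℝ → ℝ, r = fun s => ‖x (τ - s)‖ := ⟨_, rfl⟩
  obtain ⟨w, hw⟩ : ∃ w : ℝ → ℝ, w = fun s => ‖v (τ - s)‖ := ⟨_, rfl⟩
  have hr0 : ∀ s ∈ Ioc 0 s₀, 0 < r s := fun s hs => by
    rw [hr]; exact norm_pos_iff.2 (hrad s hs).1
  have hw0 : ∀ s ∈ Ioc 0 s₀, 0 < w s := fun s hs => by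
    rw [hw]; exact norm_pos_iff.2 (hrad s hs).2.1
  have hin : ∀ s ∈ Ioc 0 s₀, (x (τ - s), v (τ - s)) = (-(r s • e), w s • e) := fun s hs => by
    simp only [hr, hw]; rw [← (hrad s hs).2.2.1, ← (hrad s hs).2.2.2.1]
  have hout : ∀ s ∈ Ioc 0 s₀, (x (τ + s), v (τ + s)) = (r s • e, w s • e) := fun s hs => by
    obtain ⟨-, -, a, b, -, c, d⟩ := hrad s hs
    rw [c, d]; simp only [hr, hw]; rw [← b, ← neg_eq_iff_eq_neg.2 a]
  have hen : ∀ s ∈ Ioc 0 s₀, w s ^ 2 = 2 * (E + V (r s)) := fun s hs => by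
    simp only [hr, hw]; exact (hrad s hs).2.2.2.2.1
  have hrlim : Tendsto r (𝓝[>] 0) (𝓝 0) := by
    have h1 : ContinuousWithinAt (fun s => x (τ - s)) (Ioc 0 s₀) 0 := by
      refine ContinuousWithinAt.comp (t := Icc 0 T) (by rw [sub_zero]; exact h.continuousOn τ hτI)
        (by fun_prop) fun s hs => ⟨by linarith [hs.2], by linarith [hs.1]⟩
    have h2 := h1.norm
    rw [ContinuousWithinAt, sub_zero, h0, norm_zero, nhdsWithin_Ioc_eq_nhdsGT hs₀] at h2
    rw [hr]; exact h2
  have hsolout : ∀ a b, a ∈ Ioc 0 s₀ → b ≤ s₀ → IsSolutionOn V 0 (Icc (τ + a) (τ + b)) x v :=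
    fun a b ha hb => by
      refine h.isSolutionOn (Icc_subset_Icc (by linarith [ha.1, hτI.1]) (by linarith))
        fun t ht h' => ?_
      have h1 : t - τ ∈ Ioc 0 s₀ := ⟨by linarith [ha.1, ht.1], by linarith [ht.2]⟩
      have h2 := (hrad _ h1).2.2.2.2.2.1
      rw [add_sub_cancel, h', eq_comm, neg_eq_zero] at h2
      exact (hrad _ h1).1 h2
  have hsolin : ∀ a b, a ≤ s₀ → b ∈ Ioc 0 s₀ → IsSolutionOn V 0 (Icc (τ - a) (τ - b)) x v :=
    fun a b ha hb => by
      refine h.isSolutionOn (Icc_subset_Icc (by linarith) (by linarith [hb.1]))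
        fun t ht h' => ?_
      have h1 : τ - t ∈ Ioc 0 s₀ := ⟨by linarith [hb.1, ht.2], by linarith [ht.1]⟩
      refine (hrad _ h1).1 ?_
      rw [sub_sub_cancel, h']
  intro W hW
  obtain ⟨κ, hκ, hW⟩ := Metric.mem_nhds_iff.1 hW
  -- Continuity of the reference trajectory at the exit time.
  have hcont : ContinuousAt (fun t => (x (τ + t), v (τ + t))) s := by
    have h1 := hsolout (s / 2) s₀ ⟨by linarith [hs.1], by linarith [hs.1, hs.2]⟩ le_rfl
    have hI : Icc (τ + s / 2) (τ + s₀) ∈ 𝓝 (τ + s) :=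
      Icc_mem_nhds (by linarith [hs.1]) (by linarith [hs.2])
    have h2 := h1 (τ + s) ⟨by linarith [hs.1], by linarith [hs.2]⟩
    have h3 := (h2.2.1.hasDerivAt hI).continuousAt
    have h4 := (h2.2.2.hasDerivAt hI).continuousAt
    have h5 : ContinuousAt (fun t => τ + t) s := by fun_prop
    exact (ContinuousAt.comp (f := fun t => τ + t) h3 h5).prodMk
      (ContinuousAt.comp (f := fun t => τ + t) h4 h5)
  obtain ⟨Δ₀, hΔ₀, hnear⟩ := Metric.continuousAt_iff.1 hcont (κ / 3) (by positivity)
  obtain ⟨Δ, hΔ⟩ : ∃ Δ, Δ = min (Δ₀ / 2) (min (s / 2) ((s₀ - s) / 2)) := ⟨_, rfl⟩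
  have hs1 := hs.1
  have hs2 := hs.2
  have hΔ0 : 0 < Δ := by
    rw [hΔ]; refine lt_min (by positivity) (lt_min (by positivity) ?_); linarith
  have hΔ1 : Δ ≤ Δ₀ / 2 := hΔ ▸ min_le_left _ _
  have hΔ2 : Δ ≤ s / 2 := hΔ ▸ (min_le_right _ _).trans (min_le_left _ _)
  have hΔ3 : Δ ≤ (s₀ - s) / 2 := hΔ ▸ (min_le_right _ _).trans (min_le_right _ _)
  have hnear' : ∀ t, |t - s| ≤ Δ →
      t ∈ Ioc 0 s₀ ∧ dist (x (τ + t), v (τ + t)) (x (τ + s), v (τ + s)) < κ / 3 := fun t ht => by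
    refine ⟨?_, hnear (lt_of_le_of_lt (Real.dist_eq t s).le (by linarith))⟩
    rw [abs_le] at ht
    exact ⟨by linarith [ht.1], by linarith [ht.2]⟩
  obtain ⟨B, hB⟩ : ∃ B, B = ‖(x (τ + s), v (τ + s))‖ + κ / 3 := ⟨_, rfl⟩
  have hB0 : 0 < B := by rw [hB]; positivity
  -- `Δ` limits the time delay; `κ / (3 * B)` ensures that replacing `e` by `e'` in a state of norm
  -- at most `B` costs at most `κ / 3`.
  obtain ⟨α, hα⟩ : ∃ α, α = min Δ (κ / (3 * B)) := ⟨_, rfl⟩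
  have hα0 : 0 < α := by rw [hα]; exact lt_min hΔ0 (by positivity)
  have hαΔ : α ≤ Δ := hα ▸ min_le_left _ _
  have hαB : α * B ≤ κ / 3 := by
    have : α ≤ κ / (3 * B) := hα ▸ min_le_right _ _
    calc α * B ≤ κ / (3 * B) * B := by gcongr
      _ = κ / 3 := by field_simp
  obtain ⟨R, hR, hpass⟩ := hV.exists_pass E hα0
  -- The exit time `s₂` and the entry time `s₁`, both close to the collision.
  obtain ⟨s₂, hs₂r, hs₂0, hs₂Δ⟩ := ((hrlim.eventually_lt_const hR).and
    (Ioo_mem_nhdsGT (half_pos hΔ0))).exists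
  have hs₂I : s₂ ∈ Ioc 0 s₀ := ⟨hs₂0, by linarith⟩
  obtain ⟨s₁, hs₁r, hs₁0, hs₁₂⟩ := ((hrlim.eventually_lt_const (hr0 s₂ hs₂I)).and
    (Ioo_mem_nhdsGT hs₂0)).exists
  have hs₁I : s₁ ∈ Ioc 0 s₀ := ⟨hs₁0, by linarith⟩
  -- This `δ` depends on `s₂`, hence on `α`. The direction error is only `α`, not `δ`; the isometry
  -- below removes it before continuous dependence is invoked.
  obtain ⟨δ, hδ, hexit⟩ := (hsolout s₂ (s + Δ) hs₂I (by linarith)).exists_near hV.smooth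
    (by linarith) (by positivity : 0 < κ / 3)
  have hev := hpass (r s₁) (r s₂) (w s₁) (w s₂) e (hr0 _ hs₁I) hs₁r hs₂r.le he (hw0 _ hs₁I)
    (hw0 _ hs₂I) (hen _ hs₁I) (hen _ hs₂I) δ hδ
  rw [← hin s₁ hs₁I] at hev
  obtain ⟨δ₁, hδ₁, hev⟩ := eventually_nhdsWithin_iff_dist.1 hev
  have hentry := (hsolin s s₁ hs.2.le hs₁I).flowTendsto hV.smooth (by linarith) _
    (Metric.ball_mem_nhds _ hδ₁)
  obtain ⟨δ₂, hδ₂, hentry⟩ := eventually_nhdsWithin_iff_dist.1 hentry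
  refine eventually_nhdsWithin_iff_dist.2 ⟨min δ₂ (min δ δ₁), by positivity,
    fun y ε hy hε hε' => ?_⟩
  have hεδ₂ : ε < δ₂ := hε'.trans_le (min_le_left _ _)
  have hεδ : ε < δ := hε'.trans_le ((min_le_right _ _).trans (min_le_left _ _))
  have hεδ₁ : ε < δ₁ := hε'.trans_le ((min_le_right _ _).trans (min_le_right _ _))
  obtain ⟨y₁, hy₁, hf₁⟩ := hentry y ε (hy.trans_le (min_le_left _ _)) hε hεδ₂
  obtain ⟨t, ht, e', y₂, he', hee', hy₂, hf₂⟩ := hev y₁ ε hy₁ hε hεδ₁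
  obtain ⟨L, hL⟩ := exists_isometry_map_eq he he'
  have hLout : ∀ t ∈ Ioc 0 s₀, (L (x (τ + t)), L (v (τ + t))) = (r t • e', w t • e') :=
    fun t ht => by
      have := hout t ht
      rw [Prod.mk.injEq] at this
      rw [this.1, this.2, map_smul, map_smul, hL]
  have hy₂' : dist (L.symm y₂.1, L.symm y₂.2) (x (τ + s₂), v (τ + s₂)) < δ := by
    rw [← dist_map_phase L]
    simp only [LinearIsometryEquiv.apply_symm_apply]
    rw [hLout s₂ hs₂I]
    exact hy₂
  obtain ⟨x', v', hi, hsol, hclose⟩ := hexit _ ε hy₂' hε hεδ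
  -- The time left out of `2 * s` after the approach, of length `s - s₁`, and the passage, of length
  -- `t`.
  obtain ⟨t', ht'⟩ : ∃ t', t' = s + s₁ - t := ⟨_, rfl⟩
  have ht'0 : 0 ≤ t' := by linarith [ht.2]
  have ht'1 : t' ≤ τ + (s + Δ) - (τ + s₂) := by linarith [ht.1]
  have hf₃ := (((hsol.mono (Icc_subset_Icc_right ht'1)).map hV.smooth L).flowsTo hε ht'0)
  rw [Prod.mk.injEq] at hi
  rw [hi.1, hi.2, L.apply_symm_apply, L.apply_symm_apply] at hf₃
  refine ⟨(L (x' t'), L (v' t')), hW ?_, ?_⟩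
  -- The error is split into three parts of size `κ / 3`: continuous dependence after the exit, the
  -- change of direction, and the time shift `t' + s₂ - s = s₁ + s₂ - t`.
  · obtain ⟨hmem, hd⟩ := hnear' (t' + s₂) (abs_le.2 ⟨by linarith [ht.2], by linarith [ht.1]⟩)
    have h1 := hclose t' ⟨ht'0, ht'1⟩
    rw [← dist_map_phase L, show t' + (τ + s₂) = τ + (t' + s₂) by ring, hLout _ hmem] at h1
    rw [hout _ hmem] at hd
    have h2 : dist (r (t' + s₂) • e', w (t' + s₂) • e') (r (t' + s₂) • e, w (t' + s₂) • e) ≤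
        κ / 3 := by
      have h3 : ‖(r (t' + s₂) • e, w (t' + s₂) • e)‖ ≤ B := by
        have := norm_le_norm_add_norm_sub (x (τ + s), v (τ + s)) (r (t' + s₂) • e, w (t' + s₂) • e)
        rw [← dist_eq_norm, dist_comm] at this
        linarith
      rw [Prod.norm_def, max_le_iff] at h3
      simp only [norm_smul, he, mul_one, Real.norm_of_nonneg (hr0 _ hmem).le,
        Real.norm_of_nonneg (hw0 _ hmem).le] at h3
      rw [Prod.dist_eq]
      simp only [dist_eq_norm, ← smul_sub, norm_smul, Real.norm_of_nonneg (hr0 _ hmem).le,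
        Real.norm_of_nonneg (hw0 _ hmem).le]
      refine (max_le ?_ ?_).trans hαB
      · rw [mul_comm]; exact mul_le_mul hee' h3.1 (hr0 _ hmem).le hα0.le
      · rw [mul_comm]; exact mul_le_mul hee' h3.2 (hw0 _ hmem).le hα0.le
    have h4 := dist_triangle (L (x' t'), L (v' t')) (r (t' + s₂) • e', w (t' + s₂) • e')
      (r (t' + s₂) • e, w (t' + s₂) • e)
    have h5 := dist_triangle (L (x' t'), L (v' t')) (r (t' + s₂) • e, w (t' + s₂) • e)
      (x (τ + s), v (τ + s))
    rw [Metric.mem_ball]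
    simp only at h1
    linarith
  · have := (hf₁.trans (by linarith) ht.1.le hf₂).trans (by linarith [ht.1]) ht'0 hf₃
    convert! this using 1
    rw [ht']; ring

/-- Continuity of the flow map of the singular problem with transmission, also with respect to the
smoothing parameter. -/
theorem IsTransmissionSolution.flowTendsto (hV : ClassVStar V) {T : ℝ} (hT : 0 ≤ T)
    {x v : ℝ → Plane} (h : IsTransmissionSolution V T x v) :
    FlowTendsto V T (x 0, v 0) (x T, v T) := by
  have hreg : ∀ a b, 0 ≤ a → a ≤ b → b ≤ T → (∀ t ∈ Icc a b, x t ≠ 0) →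
      FlowTendsto V (b - a) (x a, v a) (x b, v b) := fun a b ha hab hb hne =>
    (h.isSolutionOn (Icc_subset_Icc ha hb) hne).flowTendsto hV.smooth hab
  -- Local continuity near each time, collision or not.
  have hloc : ∀ m ∈ Icc 0 T, ∃ δ > 0, (∀ t ∈ Ioo (m - δ) m, t ∈ Icc 0 T → x t ≠ 0) ∧
      ∀ a b, a ∈ Icc 0 T → b ∈ Icc 0 T → m - δ < a → a ≤ b → b < m + δ → x a ≠ 0 → x b ≠ 0 →
        FlowTendsto V (b - a) (x a, v a) (x b, v b) := by
    intro m hm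
    by_cases h0 : x m = 0
    · obtain ⟨s₀, hs₀, hm0, hmT, e, E, he, hrad⟩ := h.exists_radial hV hm h0
      have hne : ∀ t, m - s₀ < t → t < m + s₀ → t ≠ m → x t ≠ 0 := fun t h1 h2 h3 => by
        rcases h3.lt_or_gt with h4 | h4
        · have := (hrad (m - t) ⟨by linarith, by linarith⟩).1
          rwa [sub_sub_cancel] at this
        · have h5 := hrad (t - m) ⟨by linarith, by linarith⟩
          intro h6
          have h7 := h5.2.2.2.2.2.1
          rw [add_sub_cancel, h6, eq_comm, neg_eq_zero] at h7
          exact h5.1 h7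
      refine ⟨s₀, hs₀, fun t ht _ => hne t ht.1 (by linarith [ht.2]) ht.2.ne,
        fun a b ha hb h1 h2 h3 ha0 hb0 => ?_⟩
      have ham : a ≠ m := fun h' => ha0 (h' ▸ h0)
      have hbm : b ≠ m := fun h' => hb0 (h' ▸ h0)
      rcases hbm.lt_or_gt with h4 | h4
      · exact hreg a b ha.1 h2 hb.2 fun t ht => hne t (by linarith [ht.1]) (by linarith [ht.2])
          (by linarith [ht.2] : t < m).ne
      rcases ham.lt_or_gt with h5 | h5
      -- The collision lemma needs times symmetric about `m`; regular pieces fill in the rest up to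
      -- `a` and `b`.
      · obtain ⟨s, hs⟩ : ∃ s, s = min (m - a) (b - m) := ⟨_, rfl⟩
        have hs0 : 0 < s := hs ▸ lt_min (sub_pos.2 h5) (sub_pos.2 h4)
        have hsa : s ≤ m - a := hs ▸ min_le_left _ _
        have hsb : s ≤ b - m := hs ▸ min_le_right _ _
        have f1 := hreg a (m - s) ha.1 (by linarith) (by linarith [hm.2]) fun t ht =>
          hne t (by linarith [ht.1]) (by linarith [ht.2]) (by linarith [ht.2] : t < m).ne
        have f2 := h.flowTendsto_collision hV hm0 hmT he h0 hrad ⟨hs0, by linarith⟩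
        have f3 := hreg (m + s) b (by linarith [hm.1]) (by linarith) hb.2 fun t ht =>
          hne t (by linarith [ht.1]) (by linarith [ht.2]) (by linarith [ht.1] : m < t).ne'
        have := (f1.trans (by linarith) (by linarith) f2).trans (by linarith) (by linarith) f3
        convert! this using 1
        ring
      · exact hreg a b ha.1 h2 hb.2 fun t ht => hne t (by linarith [ht.1]) (by linarith [ht.2])
          (by linarith [ht.1] : m < t).ne'
    · have hev := (h.continuousOn m hm).eventually_ne h0
      obtain ⟨δ, hδ, hsub⟩ := Metric.mem_nhdsWithin_iff.1 hev
      have hne : ∀ t, m - δ < t → t < m + δ → t ∈ Icc 0 T → x t ≠ 0 := fun t h1 h2 h3 =>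
        hsub ⟨by rw [Metric.mem_ball, Real.dist_eq, abs_lt]; constructor <;> linarith, h3⟩
      exact ⟨δ, hδ, fun t ht hI => hne t ht.1 (by linarith [ht.2]) hI,
        fun a b ha hb h1 h2 h3 _ _ => hreg a b ha.1 h2 hb.2 fun t ht =>
          hne t (by linarith [ht.1]) (by linarith [ht.2]) ⟨ha.1.trans ht.1, ht.2.trans hb.2⟩⟩
  -- Collision times are skipped in the claim, since the flow is not defined at them; continuity
  -- across is obtained from regular times on either side.
  let A : Set ℝ := {t | t ∈ Icc 0 T ∧ ∀ s ∈ Icc 0 t, x s ≠ 0 →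
    FlowTendsto V s (x 0, v 0) (x s, v s)}
  have hA0 : (0 : ℝ) ∈ A := ⟨⟨le_rfl, hT⟩, fun s hs hne => by
    obtain rfl : s = 0 := le_antisymm hs.2 hs.1
    have := hreg 0 0 le_rfl le_rfl hT fun t ht => by
      obtain rfl : t = 0 := le_antisymm ht.2 ht.1
      exact hne
    rwa [sub_zero] at this⟩
  have hAb : BddAbove A := ⟨T, fun t ht => ht.1.2⟩
  obtain ⟨m, hm⟩ : ∃ m, m = sSup A := ⟨_, rfl⟩
  have hm0 : 0 ≤ m := hm ▸ le_csSup hAb hA0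
  have hmT : m ≤ T := hm ▸ csSup_le ⟨0, hA0⟩ fun t ht => ht.1.2
  obtain ⟨δ, hδ, hiso, hloc⟩ := hloc m ⟨hm0, hmT⟩
  -- A regular time close to `m` up to which continuity is known.
  obtain ⟨a, haA, ham, haδ, ha0⟩ : ∃ a ∈ A, a ≤ m ∧ m - δ < a ∧ x a ≠ 0 := by
    rcases hm0.eq_or_lt with h' | h'
    · exact ⟨0, hA0, hm0, by linarith, h.start_ne⟩
    obtain ⟨t, htA, ht⟩ := exists_lt_of_lt_csSup ⟨0, hA0⟩
      (show max (m - δ) 0 < sSup A by rw [← hm]; exact max_lt (by linarith) h')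
    have htm : t ≤ m := hm ▸ le_csSup hAb htA
    obtain ⟨s, hs1, hs2⟩ := exists_between ht
    have hs0 : 0 ≤ s := (le_max_right _ _).trans hs1.le
    have hsδ : m - δ < s := (le_max_left _ _).trans_lt hs1
    have hsT : s ≤ T := by linarith
    exact ⟨s, ⟨⟨hs0, hsT⟩, fun u hu => htA.2 u ⟨hu.1, by linarith [hu.2]⟩⟩, by linarith, hsδ,
      hiso s ⟨hsδ, by linarith⟩ ⟨hs0, hsT⟩⟩
  have hext : min (m + δ / 2) T ∈ A := by
    refine ⟨⟨le_min (by linarith) hT, min_le_right _ _⟩, fun s hs hne => ?_⟩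
    rcases le_total s a with hsa | hsa
    · exact haA.2 s ⟨hs.1, hsa⟩ hne
    have h1 := hs.2.trans (min_le_left _ _)
    have h2 := hs.2.trans (min_le_right _ _)
    have f1 := haA.2 a ⟨haA.1.1, le_rfl⟩ ha0
    have f2 := hloc a s haA.1 ⟨hs.1, h2⟩ haδ hsa (by linarith) ha0 hne
    have := f1.trans haA.1.1 (sub_nonneg.2 hsa) f2
    rwa [add_sub_cancel] at this
  have hle : min (m + δ / 2) T ≤ m := (le_csSup hAb hext).trans_eq hm.symm
  have hTm : T ≤ m + δ / 2 := by
    by_contra h'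
    rw [min_eq_left (not_le.1 h').le] at hle
    linarith
  rw [min_eq_right hTm] at hext
  exact hext.2 T ⟨hT, le_rfl⟩ h.end_ne

/-! ### Reflection of a collision solution -/

theorem force_neg (hV : ContDiffOn ℝ ∞ V (Ioi 0)) {u : Plane} (hu : u ≠ 0) :
    force V 0 (-u) = -force V 0 u := by
  rw [force_eq hV (Or.inr hu), force_eq hV (Or.inr (neg_ne_zero.2 hu)), rho_zero, rho_zero,
    norm_neg, smul_neg]

/-- The position of a collision solution, continued by reflection. -/
def reflectedPos (T₀ : ℝ) (x : ℝ → Plane) (t : ℝ) : Plane :=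
  if t < T₀ then x t else if t = T₀ then 0 else -x (2 * T₀ - t)

/-- The velocity of a collision solution, continued by reflection. -/
def reflectedVel (T₀ : ℝ) (v : ℝ → Plane) (t : ℝ) : Plane :=
  if t < T₀ then v t else v (2 * T₀ - t)

section Reflected

variable {T₀ : ℝ} {x v : ℝ → Plane} {t : ℝ}

theorem reflectedPos_of_lt (h : t < T₀) : reflectedPos T₀ x t = x t := if_pos h

theorem reflectedPos_self : reflectedPos T₀ x T₀ = 0 := by simp [reflectedPos]

theorem reflectedPos_of_gt (h : T₀ < t) : reflectedPos T₀ x t = -x (2 * T₀ - t) := by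
  rw [reflectedPos, if_neg h.not_gt, if_neg h.ne']

theorem reflectedVel_of_lt (h : t < T₀) : reflectedVel T₀ v t = v t := if_pos h

theorem reflectedVel_of_gt (h : T₀ < t) : reflectedVel T₀ v t = v (2 * T₀ - t) := if_neg h.not_gt

/-- On the reflected branch the sign of time reversal cancels the sign of the position, and for the
velocity it matches the oddness of the force. The bound `T ≤ 2 * T₀` keeps the reflected times
inside `[0, T₀)`. -/
theorem IsCollisionSolution.isTransmissionSolution (hV : ContDiffOn ℝ ∞ V (Ioi 0))
    (h : IsCollisionSolution V T₀ x v) {T : ℝ} (hT : T₀ < T) (hT' : T ≤ 2 * T₀) :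
    IsTransmissionSolution V T (reflectedPos T₀ x) (reflectedVel T₀ v) := by
  obtain ⟨hT₀, hs, hlim⟩ := h
  have hne : ∀ t ∈ Ico 0 T₀, x t ≠ 0 := fun t ht => by simpa using (hs t ht).1
  have hrefl : ∀ t ∈ Icc 0 T, T₀ < t → 2 * T₀ - t ∈ Ico 0 T₀ := fun t ht h =>
    ⟨by linarith [ht.2], by linarith⟩
  have hzero : ∀ t ∈ Icc 0 T, reflectedPos T₀ x t = 0 → t = T₀ := fun t ht h0 => by
    rcases lt_trichotomy t T₀ with h | h | h
    · rw [reflectedPos_of_lt h] at h0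
      exact absurd h0 (hne t ⟨ht.1, h⟩)
    · exact h
    · rw [reflectedPos_of_gt h, neg_eq_zero] at h0
      exact absurd h0 (hne _ (hrefl t ht h))
  have hleft : ∀ t ∈ Icc 0 T, t < T₀ → ∀ {f g : ℝ → Plane} {d : Plane},
      (∀ s, s < T₀ → f s = g s) → HasDerivWithinAt g d (Ico 0 T₀) t →
      HasDerivWithinAt f d (Icc 0 T) t := fun t ht h f g d hfg hg => by
    refine (hg.congr (fun s hs => hfg s hs.2) (hfg t h)).mono_of_mem_nhdsWithin ?_
    filter_upwards [self_mem_nhdsWithin, mem_nhdsWithin_of_mem_nhds (Iio_mem_nhds h)] with s a b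
      using ⟨a.1, b⟩
  have hright : ∀ t ∈ Icc 0 T, T₀ < t → ∀ {f g : ℝ → Plane} {d : Plane},
      (∀ s, T₀ < s → f s = g (2 * T₀ - s)) → HasDerivWithinAt g d (Ico 0 T₀) (2 * T₀ - t) →
      HasDerivWithinAt f (-d) (Icc 0 T) t := fun t ht h f g d hfg hg => by
    have h1 : HasDerivWithinAt (fun s => g (2 * T₀ - s)) ((-1 : ℝ) • d) (Ioc T₀ T) t :=
      HasDerivWithinAt.scomp t hg ((hasDerivWithinAt_id t _).const_sub (2 * T₀))
        fun s hs => hrefl s ⟨hT₀.le.trans hs.1.le, hs.2⟩ hs.1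
    rw [neg_one_smul] at h1
    refine (h1.congr (fun s hs => hfg s hs.1) (hfg t h)).mono_of_mem_nhdsWithin ?_
    filter_upwards [self_mem_nhdsWithin, mem_nhdsWithin_of_mem_nhds (Ioi_mem_nhds h)] with s a b
      using ⟨b, a.2⟩
  have hmotion : ∀ t ∈ Icc 0 T, reflectedPos T₀ x t ≠ 0 →
      HasDerivWithinAt (reflectedPos T₀ x) (reflectedVel T₀ v t) (Icc 0 T) t ∧
      HasDerivWithinAt (reflectedVel T₀ v) (force V 0 (reflectedPos T₀ x t)) (Icc 0 T) t := by
    intro t ht h0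
    rcases lt_trichotomy t T₀ with h | h | h
    · rw [reflectedPos_of_lt h, reflectedVel_of_lt h]
      have h1 := hs t ⟨ht.1, h⟩
      exact ⟨hleft t ht h (fun _ => reflectedPos_of_lt) h1.2.1,
        hleft t ht h (fun _ => reflectedVel_of_lt) h1.2.2⟩
    · exact absurd (h ▸ reflectedPos_self) h0
    · have h1 := hs _ (hrefl t ht h)
      rw [reflectedPos_of_gt h, reflectedVel_of_gt h, force_neg hV (hne _ (hrefl t ht h))]
      refine ⟨?_, hright t ht h (fun _ => reflectedVel_of_gt) h1.2.2⟩
      have := hright t ht h (f := reflectedPos T₀ x) (g := -x) (fun _ => reflectedPos_of_gt)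
        h1.2.1.neg
      rwa [neg_neg] at this
  refine ⟨fun h0 => ?_, fun h0 => ?_, fun t ht => ?_, hmotion, fun τ hτ h0 => ?_⟩
  · exact hT₀.ne (hzero 0 ⟨le_rfl, by linarith⟩ h0)
  · exact hT.ne' (hzero T ⟨by linarith, le_rfl⟩ h0)
  · by_cases h0 : reflectedPos T₀ x t = 0
    · rw [hzero t ht h0]
      refine (continuousAt_iff_continuous_left'_right'.2 ⟨?_, ?_⟩).continuousWithinAt
      · rw [ContinuousWithinAt, reflectedPos_self]
        refine hlim.congr' ?_
        filter_upwards [self_mem_nhdsWithin] with s hs' using (reflectedPos_of_lt hs').symm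
      · rw [ContinuousWithinAt, reflectedPos_self]
        have h1 : Tendsto (fun s => 2 * T₀ - s) (𝓝[>] T₀) (𝓝[<] T₀) := by
          refine tendsto_nhdsWithin_iff.2 ⟨?_, ?_⟩
          · have : Tendsto (fun s => 2 * T₀ - s) (𝓝 T₀) (𝓝 (2 * T₀ - T₀)) :=
              (continuous_const.sub continuous_id).tendsto T₀
            rw [show 2 * T₀ - T₀ = T₀ by ring] at this
            exact this.mono_left nhdsWithin_le_nhds
          · filter_upwards [self_mem_nhdsWithin] with s hs'
            rw [mem_Iio]
            linarith [mem_Ioi.1 hs']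
        have h2 := (hlim.comp h1).neg
        rw [neg_zero] at h2
        refine h2.congr' ?_
        filter_upwards [self_mem_nhdsWithin] with s hs' using (reflectedPos_of_gt hs').symm
    · exact (hmotion t ht h0).1.continuousWithinAt
  · rw [hzero τ hτ h0]
    filter_upwards [Ioc_mem_nhdsGT hT₀] with s hs'
    have h1 : T₀ - s < T₀ := sub_lt_self _ hs'.1
    have h2 : T₀ < T₀ + s := lt_add_of_pos_right _ hs'.1
    have h3 : 2 * T₀ - (T₀ + s) = T₀ - s := by ring
    rw [reflectedPos_of_lt h1, reflectedPos_of_gt h2, reflectedVel_of_lt h1,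
      reflectedVel_of_gt h2, h3]
    exact ⟨hne _ ⟨by linarith [hs'.2], h1⟩, rfl, rfl⟩

theorem IsCollisionSolution.flowsTo (hV : ContDiffOn ℝ ∞ V (Ioi 0))
    (h : IsCollisionSolution V T₀ x v) {T : ℝ} (hT : T₀ < T) (hT' : T ≤ 2 * T₀) :
    FlowsTo V T (x 0, v 0) 0 (-x (2 * T₀ - T), v (2 * T₀ - T)) := by
  refine ⟨_, _, ?_, ?_, Or.inr ⟨rfl, h.isTransmissionSolution hV hT hT'⟩⟩
  · rw [reflectedPos_of_lt h.1, reflectedVel_of_lt h.1]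
  · rw [reflectedPos_of_gt hT, reflectedVel_of_gt hT]

end Reflected

/-! ### The time map and the theorem. -/

theorem timeMap_eq (hV : ContDiffOn ℝ ∞ V (Ioi 0)) {T : ℝ} (hT : 0 ≤ T) {p : Phase × ℝ}
    {z : Phase} (h : FlowsTo V T p.1 p.2 z) : timeMap V T p = z := by
  have hex : ∃ z, FlowsTo V T p.1 p.2 z := ⟨z, h⟩
  rw [timeMap, dif_pos hex]
  exact hex.choose_spec.unique hV hT h

end OneCentre

end

theorem mainTheorem4 (V : ℝ → ℝ) (hV : OneCentre.ClassVStar V)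
    (S B : EReal) (hS : 0 < S) (hB : 0 < B)
    (hVS : OneCentre.DecreasingConvexOn V S) (hVB : OneCentre.RatioBoundOn V B)
    (ybar : OneCentre.Phase) (hq : (‖ybar.1‖ : EReal) ≤ min B S)
    (T₀ : ℝ) (xbar vbar : ℝ → OneCentre.Plane)
    (hcoll : OneCentre.IsCollisionSolution V T₀ xbar vbar)
    (hinit : (xbar 0, vbar 0) = ybar) :
    (∀ T : ℝ, T₀ < T → T ≤ 2 * T₀ →
      OneCentre.FlowsTo V T ybar 0 (-xbar (2 * T₀ - T), vbar (2 * T₀ - T))) ∧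
    ∀ T : ℝ, T₀ < T → (∃ z, OneCentre.FlowsTo V T ybar 0 z) →
      (OneCentre.timeMap V T (ybar, 0)).2 ≠ 0 →
      (∀ᶠ p : OneCentre.Phase × ℝ in 𝓝[{p | 0 ≤ p.2}] (ybar, 0),
        ∃! z, OneCentre.FlowsTo V T p.1 p.2 z) ∧
      Tendsto (OneCentre.timeMap V T) (𝓝[{p | 0 ≤ p.2}] (ybar, 0))
        (𝓝 (OneCentre.timeMap V T (ybar, 0))) := by
  refine ⟨fun T hT hT' => hinit ▸ hcoll.flowsTo hV.smooth hT hT', ?_⟩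
  rintro T hT ⟨z, hz⟩ -
  have hT0 : 0 ≤ T := (hcoll.1.trans hT).le
  rw [OneCentre.timeMap_eq hV.smooth hT0 (p := (ybar, 0)) hz]
  have key : OneCentre.FlowTendsto V T ybar z := by
    obtain ⟨x, v, rfl, rfl, ⟨h, -⟩ | ⟨-, h⟩⟩ := hz
    · exact absurd h (lt_irrefl 0)
    · exact h.flowTendsto hV hT0
  -- Existence is `FlowTendsto` tested on the whole space and convergence is the same statement on
  -- small neighbourhoods; uniqueness identifies the state found with the value of `timeMap`.
  constructor
  · filter_upwards [key _ Filter.univ_mem] with p hp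
    obtain ⟨z', -, hz'⟩ := hp
    exact ⟨z', hz', fun w hw => hw.unique hV.smooth hT0 hz'⟩
  · intro W hW
    rw [Filter.mem_map]
    filter_upwards [key W hW] with p hp
    obtain ⟨z', hz'W, hz'⟩ := hp
    rw [Set.mem_preimage, OneCentre.timeMap_eq hV.smooth hT0 hz']
    exact hz'W
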